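/- Let $n,k\ge 0$. On the phase space $\mathbb R^{2n}=\{X=(P,Q): P,Q\in\mathbb R^n\}$ let $\omega(X,X')=\sum_j(P_jQ_j'-P_j'Q_j)$, and let $\Omega(X)=\sum_j\bigl(P_j\xi_j-Q_j\tfrac1i\tfrac{\partial}{\partial\xi_j}\bigr)$, so that $(e^{i\Omega(P,Q)}\psi)(\xi)=e^{i(P\cdot\xi-P\cdot Q/2)}\psi(\xi-Q)$; this operator acts on $\mathcal S(\mathbb R^n)$ and, by duality, on $\mathcal S'(\mathbb R^n)$. Write $(\varphi,\psi)=\int \overline{\varphi}\,\psi\,d\xi$. Let $\mathcal L_k\subset\mathbb R^{2n}$ be an isotropic plane (a $k$-dimensional linear subspace on which $\omega$ vanishes) with a (nonzero, locally finite) translation-invariant measure $d\mu$. Let $\mathcal G_k$ be a gauge surface for $\mathcal L_k$ (a $k$-dimensional isotropic plane such that $\omega$ is nondegenerate on $\mathcal L_k+\mathcal G_k$) with a (nonzero, locally finite) translation-invariant measure $d\sigma$. For $\varphi,\psi\in\mathcal S(\mathbb R^n)$ put $\langle\varphi,\psi\rangle=\int_{\mathcal L_k}d\mu(X)\,(\varphi,e^{i\Omega(X)}\psi)$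 and $\eta\psi=\int_{\mathcal L_k}d\mu(X)\,e^{i\Omega(X)}\psi\in\mathcal S'(\mathbb R^n)$, and let $\mathcal H$ be the completion of $\mathcal S(\mathbb R^n)/\{\psi:\langle\psi,\psi\rangle=0\}$. The Dirac space $\mathcal H_D\subset\mathcal S'(\mathbb R^n)$ is the image of $\mathcal H$ under the continuous extension $\overline\eta$ of $\eta$: it consists of all $\psi_D=\lim_m\eta\psi_m$ (limit in $\mathcal S'(\mathbb R^n)$), where $(\psi_m)\subset\mathcal S(\mathbb R^n)$ is a Cauchy sequence for $\langle\cdot,\cdot\rangle$. The Dirac inner product is $\langle\overline\eta\,\overline\psi,\overline\eta\,\overline\psi\rangle_D=\langle\overline\psi,\overline\psi\rangle$, that is, $\langle\psi_D,\psi_D\rangle_D=\lim_m\langle\psi_m,\psi_m\rangle$ for every such sequence $(\psi_m)$. For $\psi_D\in\mathcal S'(\mathbb R^n)$ the distribution $R(Y)=(\psi_D,e^{i\Omega(Y)}\psi_D)$ on $\mathbb R^{2n}$ is given by $\int dY\,F(Y)R(Y)=\bigl(\psi_D,\int dY\,F(Y)e^{i\Omega(Y)}\psi_D\bigr)$ for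 $F\in\mathcal S(\mathbb R^{2n})$, where $\int dY\,F(Y)e^{i\Omega(Y)}\psi_D$ belongs to $\mathcal S(\mathbb R^n)$. A distribution $R$ on $\mathbb R^{2n}$ possesses a restriction to $\mathcal G_k$ if, for every linear complement $\mathcal N$ of $\mathcal G_k$, with the Lebesgue measure $d\nu$ on $\mathcal N$ such that $dY=d\sigma(x)\,d\nu(y)$ for $Y=x+y$, and for every $f\in\mathcal S(\mathcal G_k)$, the distribution $R_f(y)=\int d\sigma(x)f(x)R(x+y)$ on $\mathcal N$ is a continuous function of $y$ in a vicinity of $y=0$, the value $\int_{\mathcal G_k}d\sigma(x)f(x)R(x):=R_f(0)$ being the same for all $\mathcal N$. There is a constant $\Delta>0$, depending only on $\mathcal L_k,\mathcal G_k,d\mu,d\sigma$, such that the following holds. 1. For every $\rho\in\mathcal S(\mathcal G_k)$ the iterated integral converges absolutely (the inner integral for each $X$, and then the outer one) and $$\int_{\mathcal L_k} d\mu(X)\int_{\mathcal G_k} d\sigma(Y)\,\rho(Y)\,e^{i\omega(X,Y)}=\rho(0)\cdot\Delta .$$ 2. For every $\psi_D\in\mathcal H_D$, $(\psi_D,e^{i\Omega(Y)}\psi_D)$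 is a tempered distribution on $\mathbb R^{2n}$ that possesses a restriction to $\mathcal G_k$, which is a tempered distribution on $\mathcal G_k$, and for every $\rho\in\mathcal S(\mathcal G_k)$ with $\rho(0)=1/\Delta$, $$\langle\psi_D,\psi_D\rangle_D=\int_{\mathcal G_k}d\sigma(Y)\,\rho(Y)\,(\psi_D,e^{i\Omega(Y)}\psi_D).$$ -/

import Mathlib

open MeasureTheory Filter Topology
open scoped SchwartzMap

noncomputable section

/-- The configuration space `ℝⁿ` with its Euclidean structure. -/
abbrev Conf (n : ℕ) : Type := EuclideanSpace ℝ (Fin n)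

/-- The phase space `ℝ²ⁿ` of pairs `(P, Q)` (momenta, coordinates). -/
abbrev Phase (n : ℕ) : Type := Conf n × Conf n

/-- The symplectic form `ω((P,Q),(P',Q')) = ∑ⱼ (Pⱼ Q'ⱼ - P'ⱼ Qⱼ)`. -/
def symp {n : ℕ} (X Y : Phase n) : ℝ :=
  ∑ j, (X.1 j * Y.2 j - Y.1 j * X.2 j)

/-- A `k`-dimensional isotropic plane (linear subspace) in the phase space. -/
def IsIsotropicPlane {n : ℕ} (k : ℕ) (L : Submodule ℝ (Phase n)) : Prop :=
  Module.finrank ℝ L = k ∧ ∀ X ∈ L, ∀ Y ∈ L, symp X Y = 0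

/-- `G` is a gauge surface for the `k`-dimensional plane `L`: it is a `k`-dimensional isotropic
plane and `ω` is nondegenerate on `L + G`. -/
def IsGaugeSurface {n : ℕ} (k : ℕ) (L G : Submodule ℝ (Phase n)) : Prop :=
  IsIsotropicPlane k G ∧ ∀ Z ∈ L ⊔ G, (∀ W ∈ L ⊔ G, symp Z W = 0) → Z = 0

/-! ### The operators `Ω(X)` and `exp (i Ω(X))` -/

/-- `P · ξ = ∑ⱼ Pⱼ ξⱼ`. -/
def dotp {n : ℕ} (P ξ : Conf n) : ℝ := ∑ j, P j * ξ j

/-- The operator `Ω(P,Q) = ∑ⱼ (Pⱼ ξⱼ - Qⱼ (1/i) ∂/∂ξⱼ)`, acting on functions of `ξ`. -/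
def omegaOp {n : ℕ} (X : Phase n) (ψ : Conf n → ℂ) (ξ : Conf n) : ℂ :=
  (dotp X.1 ξ : ℂ) * ψ ξ - (1 / Complex.I) * fderiv ℝ ψ ξ X.2

/-- The phase factor `exp (i (P · ξ - P · Q / 2))`. -/
def weylPhase {n : ℕ} (X : Phase n) (ξ : Conf n) : ℂ :=
  Complex.exp (Complex.I * ((dotp X.1 ξ - dotp X.1 X.2 / 2 : ℝ) : ℂ))

/-- The unitary operator `exp (i Ω(P,Q))` on the Schwartz space:
`(exp (i Ω(P,Q)) ψ)(ξ) = exp (i (P · ξ - P · Q / 2)) ψ(ξ - Q)`.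
See `weyl_apply` and `weyl_hasDerivAt` below. -/
def weyl {n : ℕ} (X : Phase n) : 𝓢(Conf n, ℂ) →L[ℂ] 𝓢(Conf n, ℂ) :=
  (SchwartzMap.smulLeftCLM ℂ (weylPhase X)).comp (SchwartzMap.compSubConstCLM ℂ X.2)

theorem dotp_eq_inner {n : ℕ} (P ξ : Conf n) : dotp P ξ = inner ℝ P ξ := by
  simp only [dotp, PiLp.inner_apply, RCLike.inner_apply, conj_trivial]
  exact Finset.sum_congr rfl fun j _ => mul_comm _ _

theorem expI_hasTemperateGrowth :
    (fun t : ℝ => Complex.exp (Complex.I * (t : ℂ))).HasTemperateGrowth := by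
  have hd : ∀ t : ℝ, HasDerivAt (fun t : ℝ => Complex.exp (Complex.I * (t : ℂ)))
      (Complex.I * Complex.exp (Complex.I * (t : ℂ))) t := by
    intro t
    have h := (((Complex.ofRealCLM.hasDerivAt (x := t)).const_mul Complex.I).cexp)
    simpa [mul_comm] using h
  have hit : ∀ m : ℕ, iteratedDeriv m (fun t : ℝ => Complex.exp (Complex.I * (t : ℂ)))
      = fun t : ℝ => Complex.I ^ m * Complex.exp (Complex.I * (t : ℂ)) := by
    intro m
    induction m with
    | zero => simp
    | succ m ih =>
      rw [iteratedDeriv_succ, ih]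
      funext t
      rw [((hd t).const_mul (Complex.I ^ m)).deriv, pow_succ]
      ring
  refine ⟨(contDiff_const.mul Complex.ofRealCLM.contDiff).cexp, fun m => ⟨0, 1, fun t => ?_⟩⟩
  rw [norm_iteratedFDeriv_eq_norm_iteratedDeriv, hit m]
  simp [Complex.norm_exp]

theorem weylPhase_hasTemperateGrowth {n : ℕ} (X : Phase n) :
    (weylPhase X).HasTemperateGrowth := by
  have h : (fun ξ : Conf n => dotp X.1 ξ - dotp X.1 X.2 / 2).HasTemperateGrowth := by
    simp only [dotp_eq_inner]
    fun_prop
  exact expI_hasTemperateGrowth.comp h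

theorem weyl_apply {n : ℕ} (X : Phase n) (ψ : 𝓢(Conf n, ℂ)) (ξ : Conf n) :
    weyl X ψ ξ = weylPhase X ξ * ψ (ξ - X.2) := by
  simp [weyl, SchwartzMap.smulLeftCLM_apply_apply (weylPhase_hasTemperateGrowth X)]

theorem weyl_zero {n : ℕ} (ψ : 𝓢(Conf n, ℂ)) : weyl 0 ψ = ψ := by
  ext ξ
  simp [weyl_apply, weylPhase, dotp]

/-- `t ↦ exp (i Ω(t X)) ψ` solves `dψₜ/dt = i Ω(X) ψₜ`, so that `weyl X` is `exp (i Ω(X))`. -/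
theorem weyl_hasDerivAt {n : ℕ} (X : Phase n) (ψ : 𝓢(Conf n, ℂ)) (ξ : Conf n) (t : ℝ) :
    HasDerivAt (fun s : ℝ => weyl (s • X) ψ ξ)
      (Complex.I * omegaOp X (weyl (t • X) ψ) ξ) t := by
  have hW : ∀ (s : ℝ) (η : Conf n), weyl (s • X) ψ η
      = Complex.exp (Complex.I * ((s * dotp X.1 η - s ^ 2 * dotp X.1 X.2 / 2 : ℝ) : ℂ))
        * ψ (η - s • X.2) := by
    intro s η
    rw [weyl_apply, weylPhase]
    simp only [dotp_eq_inner, Prod.smul_fst, Prod.smul_snd, real_inner_smul_left,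
      real_inner_smul_right]
    congr 4
    ring
  have hψ : ∀ η, HasFDerivAt (ψ : Conf n → ℂ) (fderiv ℝ ψ η) η := fun η =>
    ψ.differentiableAt.hasFDerivAt
  have h1 : HasDerivAt (fun s : ℝ => weyl (s • X) ψ ξ)
      (Complex.exp (Complex.I * ((t * dotp X.1 ξ - t ^ 2 * dotp X.1 X.2 / 2 : ℝ) : ℂ))
        * (Complex.I * ((dotp X.1 ξ - t * dotp X.1 X.2 : ℝ) : ℂ)) * ψ (ξ - t • X.2)
      + Complex.exp (Complex.I * ((t * dotp X.1 ξ - t ^ 2 * dotp X.1 X.2 / 2 : ℝ) : ℂ))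
        * fderiv ℝ ψ (ξ - t • X.2) (-X.2)) t := by
    simp only [hW]
    refine HasDerivAt.mul (HasDerivAt.cexp (HasDerivAt.const_mul _ (HasDerivAt.ofReal_comp ?_))) ?_
    · have h := ((hasDerivAt_id t).mul_const (dotp X.1 ξ)).sub
        ((((hasDerivAt_id t).pow 2).mul_const (dotp X.1 X.2)).div_const 2)
      refine h.congr_deriv ?_
      simp
      ring
    · refine (hψ _).comp_hasDerivAt t ?_
      have h := ((hasDerivAt_id t).smul_const X.2).const_sub ξ
      simpa using h
  have h2 : HasDerivAt (fun s : ℝ => weyl (t • X) ψ (ξ + s • X.2))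
      (Complex.exp (Complex.I * ((t * dotp X.1 ξ - t ^ 2 * dotp X.1 X.2 / 2 : ℝ) : ℂ))
        * (Complex.I * ((t * dotp X.1 X.2 : ℝ) : ℂ)) * ψ (ξ - t • X.2)
      + Complex.exp (Complex.I * ((t * dotp X.1 ξ - t ^ 2 * dotp X.1 X.2 / 2 : ℝ) : ℂ))
        * fderiv ℝ ψ (ξ - t • X.2) X.2) 0 := by
    have e : ∀ s : ℝ, dotp X.1 (ξ + s • X.2) = dotp X.1 ξ + s * dotp X.1 X.2 := by
      intro s
      simp only [dotp_eq_inner, inner_add_right, real_inner_smul_right]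
    simp only [hW, e]
    have ha : HasDerivAt (fun s : ℝ => t * (dotp X.1 ξ + s * dotp X.1 X.2)
        - t ^ 2 * dotp X.1 X.2 / 2) (t * dotp X.1 X.2) 0 := by
      have h := ((((hasDerivAt_id (0 : ℝ)).mul_const (dotp X.1 X.2)).const_add
        (dotp X.1 ξ)).const_mul t).sub_const (t ^ 2 * dotp X.1 X.2 / 2)
      simpa using h
    have hb : HasDerivAt (fun s : ℝ => ξ + s • X.2 - t • X.2) X.2 0 := by
      have h := (((hasDerivAt_id (0 : ℝ)).smul_const X.2).const_add ξ).sub_const (t • X.2)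
      simpa using h
    have hc := HasFDerivAt.comp_hasDerivAt (0 : ℝ) (hψ _) hb
    have h := ((ha.ofReal_comp.const_mul Complex.I).cexp).mul hc
    refine HasDerivAt.congr_deriv h ?_
    simp
  have h3 : fderiv ℝ (weyl (t • X) ψ) ξ X.2 =
      Complex.exp (Complex.I * ((t * dotp X.1 ξ - t ^ 2 * dotp X.1 X.2 / 2 : ℝ) : ℂ))
        * (Complex.I * ((t * dotp X.1 X.2 : ℝ) : ℂ)) * ψ (ξ - t • X.2)
      + Complex.exp (Complex.I * ((t * dotp X.1 ξ - t ^ 2 * dotp X.1 X.2 / 2 : ℝ) : ℂ))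
        * fderiv ℝ ψ (ξ - t • X.2) X.2 := by
    have hd : HasFDerivAt (weyl (t • X) ψ : Conf n → ℂ) (fderiv ℝ (weyl (t • X) ψ) ξ)
        (ξ + (0 : ℝ) • X.2) := by
      simpa using (weyl (t • X) ψ).differentiableAt.hasFDerivAt
    have hb : HasDerivAt (fun s : ℝ => ξ + s • X.2) X.2 0 := by
      have h := ((hasDerivAt_id (0 : ℝ)).smul_const X.2).const_add ξ
      simpa using h
    exact (hd.comp_hasDerivAt (0 : ℝ) hb).unique h2
  refine h1.congr_deriv ?_
  rw [omegaOp, h3, hW]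
  simp only [map_neg, one_div, Complex.inv_I]
  push_cast
  linear_combination (Complex.exp (Complex.I * (t * dotp X.1 ξ - t ^ 2 * dotp X.1 X.2 / 2))
    * (- Complex.I * (t * dotp X.1 X.2) * ψ (ξ - t • X.2)
       - fderiv ℝ ψ (ξ - t • X.2) X.2)) * Complex.I_sq

/-- The Weyl relation `exp (iΩ(X)) exp (iΩ(X')) = exp (iΩ(X + X')) exp ((i/2) ω(X,X'))`. -/
theorem weyl_weyl {n : ℕ} (X Y : Phase n) (ψ : 𝓢(Conf n, ℂ)) :
    weyl X (weyl Y ψ) = Complex.exp (Complex.I / 2 * (symp X Y : ℂ)) • weyl (X + Y) ψ := by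
  ext ξ
  have hs : symp X Y = dotp X.1 Y.2 - dotp Y.1 X.2 := by
    simp [symp, dotp, Finset.sum_sub_distrib]
  have hξ : ξ - X.2 - Y.2 = ξ - (X + Y).2 := by
    rw [Prod.snd_add, sub_sub]
  rw [smul_apply, weyl_apply, weyl_apply, weyl_apply, hξ, smul_eq_mul, ← mul_assoc,
    ← mul_assoc]
  congr 1
  simp only [weylPhase]
  rw [← Complex.exp_add, ← Complex.exp_add, hs]
  congr 1
  simp only [dotp_eq_inner, Prod.fst_add, Prod.snd_add, inner_add_left, inner_add_right,
    inner_sub_right]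
  push_cast
  ring

/-- The transpose of `exp (i Ω(P,Q))` for the bilinear pairing `∫ ψ χ dξ` is
`exp (i Ω(P,-Q))`. -/
theorem integral_weyl_mul {n : ℕ} (X : Phase n) (ψ χ : 𝓢(Conf n, ℂ)) :
    ∫ ξ, weyl X ψ ξ * χ ξ = ∫ ξ, ψ ξ * weyl (X.1, -X.2) χ ξ := by
  rw [← integral_add_right_eq_self (fun ξ => weyl X ψ ξ * χ ξ) X.2]
  congr 1
  funext ξ
  have h : weylPhase X (ξ + X.2) = weylPhase (X.1, -X.2) ξ := by
    simp only [weylPhase, dotp_eq_inner, inner_add_right, inner_neg_right]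
    congr 3
    ring
  simp only [weyl_apply, h, sub_neg_eq_add, add_sub_cancel_right]
  ring

/-- `exp (i Ω(Y))` on tempered distributions, the transpose of `exp (i Ω(P,-Q))`; by
`integral_weyl_mul` it extends `exp (i Ω(Y))` on Schwartz functions. -/
def weylDistr {n : ℕ} (Y : Phase n) (ψ : 𝓢'(Conf n, ℂ)) (χ : 𝓢(Conf n, ℂ)) : ℂ :=
  ψ (weyl (Y.1, -Y.2) χ)

/-- Complex conjugation of Schwartz functions. -/
def conjS {n : ℕ} (ψ : 𝓢(Conf n, ℂ)) : 𝓢(Conf n, ℂ) :=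
  SchwartzMap.postcompCLM (𝕜 := ℝ) (Complex.conjCLE : ℂ →L[ℝ] ℂ) ψ

theorem conjS_apply {n : ℕ} (ψ : 𝓢(Conf n, ℂ)) (ξ : Conf n) :
    conjS ψ ξ = (starRingEnd ℂ) (ψ ξ) := rfl

/-! ### The algebraic inner product and the Dirac space -/

/-- The inner product `(φ, ψ) = ∫ φ* ψ dξ`. -/
def innerS {n : ℕ} (φ ψ : 𝓢(Conf n, ℂ)) : ℂ :=
  ∫ ξ, (starRingEnd ℂ) (φ ξ) * ψ ξ

/-- The algebraic inner product `⟨φ, ψ⟩ = ∫_L dμ(X) (φ, exp (i Ω(X)) ψ)`. -/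
def algInner {n : ℕ} {L : Submodule ℝ (Phase n)} (μ : Measure L) (φ ψ : 𝓢(Conf n, ℂ)) : ℂ :=
  ∫ X : L, innerS φ (weyl (X : Phase n) ψ) ∂μ

/-- The distribution `η ψ = ∫_L dμ(X) exp (i Ω(X)) ψ`, evaluated at the test function `χ`. -/
def etaMap {n : ℕ} {L : Submodule ℝ (Phase n)} (μ : Measure L) (ψ χ : 𝓢(Conf n, ℂ)) : ℂ :=
  ∫ X : L, (∫ ξ, weyl (X : Phase n) ψ ξ * χ ξ) ∂μ

/-- The sequence `u` is fundamental for the seminorm of the algebraic inner product, so that it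
represents a vector of the completion of the quotient of the Schwartz space by the null vectors. -/
def IsFundamental {n : ℕ} {L : Submodule ℝ (Phase n)} (μ : Measure L)
    (u : ℕ → 𝓢(Conf n, ℂ)) : Prop :=
  ∀ ε : ℝ, 0 < ε → ∃ M : ℕ, ∀ m ≥ M, ∀ l ≥ M, ‖algInner μ (u m - u l) (u m - u l)‖ < ε

/-- `ψD` is the image, under the continuous extension of `η` to the completion, of the vector that
the fundamental sequence `u` represents: `η (u m) → ψD` in the space of tempered distributions. -/
def Represents {n : ℕ} {L : Submodule ℝ (Phase n)} (μ : Measure L)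
    (u : ℕ → 𝓢(Conf n, ℂ)) (ψD : 𝓢'(Conf n, ℂ)) : Prop :=
  IsFundamental μ u ∧ ∀ χ : 𝓢(Conf n, ℂ), Tendsto (fun m => etaMap μ (u m) χ) atTop (𝓝 (ψD χ))

/-- The physical space of the Dirac approach: the image of the completion under the extension
of `η`. -/
def diracSpace {n : ℕ} {L : Submodule ℝ (Phase n)} (μ : Measure L) : Set (𝓢'(Conf n, ℂ)) :=
  {ψD | ∃ u, Represents μ u ψD}

/-- `z` is the Dirac inner product `⟨ψD, ψD⟩_D`, i.e. the inner square in the completion of the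
vector that `ψD` comes from: the limit of `⟨u m, u m⟩` for every sequence `u` representing `ψD`. -/
def IsDiracInnerSelf {n : ℕ} {L : Submodule ℝ (Phase n)} (μ : Measure L)
    (ψD : 𝓢'(Conf n, ℂ)) (z : ℂ) : Prop :=
  ψD ∈ diracSpace μ ∧
    ∀ u, Represents μ u ψD → Tendsto (fun m => algInner μ (u m) (u m)) atTop (𝓝 z)

/-! ### The distribution `(ψ, exp (i Ω(Y)) ψ)` and its restriction to a plane -/

/-- The Schwartz function `g` is the distribution `∫ dY F(Y) exp (i Ω(Y)) ψ`, the integral being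
absolutely convergent against every test function. -/
def IsSmeared {n : ℕ} (ψ : 𝓢'(Conf n, ℂ)) (F : 𝓢(Phase n, ℂ)) (g : 𝓢(Conf n, ℂ)) : Prop :=
  ∀ χ : 𝓢(Conf n, ℂ), Integrable (fun Y : Phase n => F Y * weylDistr Y ψ χ) ∧
    ∫ ξ, g ξ * χ ξ = ∫ Y : Phase n, F Y * weylDistr Y ψ χ

/-- The tempered distribution `R` on the phase space is `R(Y) = (φ, exp (i Ω(Y)) ψ)` for the
tempered distributions `φ`, `ψ`: for each test function `F`, the distribution
`∫ dY F(Y) exp (i Ω(Y)) ψ` is a Schwartz function `g`, and `∫ dY F(Y) R(Y) = (φ, g)`, where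
`(φ, g) = (∫ φ g*)*`. -/
def IsMatrixElement {n : ℕ} (φ ψ : 𝓢'(Conf n, ℂ)) (R : 𝓢'(Phase n, ℂ)) : Prop :=
  ∀ F : 𝓢(Phase n, ℂ), ∃ g : 𝓢(Conf n, ℂ), IsSmeared ψ F g ∧
    R F = (starRingEnd ℂ) (φ (conjS g))

/-- The distribution `R` on the phase space possesses a restriction to the plane `G` with measure
`σ`, and `S` is this restriction. That is, for each complement `N` of `G`, with the Lebesgue
measure `ν` such that `dY = dσ(x) dν(y)` for `Y = x + y`, `x ∈ G`, `y ∈ N`, and for each test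
function `f` on `G`, the distribution `∫ dσ(x) f(x) R(x + y)` in `y` is, in a vicinity `U` of
`y = 0`, a continuous function `h(y)`, and the value `∫ dσ(x) f(x) R(x)` of the restriction
at `f` is `h(0)`. -/
def IsRestriction {n : ℕ} (R : 𝓢'(Phase n, ℂ)) (G : Submodule ℝ (Phase n)) (σ : Measure G)
    (S : 𝓢'(G, ℂ)) : Prop :=
  ∀ (N : Submodule ℝ (Phase n)) (ν : Measure N), IsCompl G N → ν.IsAddHaarMeasure →
    Measure.map (fun p : G × N => (p.1 : Phase n) + (p.2 : Phase n)) (σ.prod ν) = volume →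
    ∀ f : 𝓢(G, ℂ), ∃ U ∈ 𝓝 (0 : N), ∃ h : N → ℂ, ContinuousOn h U ∧ h 0 = S f ∧
      ∀ χ : 𝓢(N, ℂ), HasCompactSupport χ → tsupport χ ⊆ U →
        ∀ F : 𝓢(Phase n, ℂ), (∀ (x : G) (y : N), F ((x : Phase n) + (y : Phase n)) = f x * χ y) →
          R F = ∫ y, χ y * h y ∂ν

end

/-!
Let `ℋ` be the completion of the Schwartz space for `⟨·, ·⟩`. A Dirac distribution `ψD` comes from
a vector `Ψ` of `ℋ`, through `ψD χ = ⟨χ*, Ψ⟩`. The operators `exp (i Ω(X))`, `X ∈ L`, act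
trivially on `ℋ`, and those with `z` in the symplectic complement `L^ω` induce unitary operators
`U(z)`, which are strongly continuous. If `g = ∫ F(Y) exp (i Ω(Y)) ψD dY`, moving `exp (i Ω(X))`
past `exp (i Ω(Y))` gives `⟨φ, g⟩ = ∫_L dμ(X) ∫ dY exp (i ω(X, Y)) F(Y) ⟨exp (-i Ω(Y)) φ, Ψ⟩`.
Since the phases are trivial along `L^ω`, of which `G` is a complement, Fourier inversion at the
origin of `G`, with constant `Δ`, collapses this to `Δ ∫ F(z) ⟨φ, U(z) Ψ⟩ dν(z)` over `L^ω`. Thus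
the matrix element of `ψD` is carried by `L^ω`, with the continuous bounded density
`Δ ⟨Ψ, U(z) Ψ⟩`, and its restriction to the transversal plane `G` is `Δ ⟨Ψ, Ψ⟩` times the delta
distribution at `0`.
-/

open scoped LineDeriv

noncomputable section

/-! ### Schwartz functions from bounds on line derivatives -/

section LineDerivatives

variable {E F : Type*} [NormedAddCommGroup E] [NormedSpace ℝ E] [NormedAddCommGroup F]
  [NormedSpace ℝ F] {f : E → F}

theorem hasDerivAt_comp_line {x w : E} {t : ℝ} {a : F} (h : HasLineDerivAt ℝ f a (x + t • w) w) :
    HasDerivAt (fun s : ℝ => f (x + s • w)) a t := by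
  have hs : HasDerivAt (fun s : ℝ => f (x + t • w + (s - t) • w)) a t := by
    have h' : HasDerivAt (fun s : ℝ => f (x + t • w + s • w)) a (t - t) := by
      rw [sub_self]
      exact h
    simpa using h'.comp_sub_const t t
  refine hs.congr_of_eventuallyEq (.of_forall fun s => ?_)
  simp only [sub_smul, add_assoc, add_sub_cancel]

theorem norm_sub_sub_le_of_hasLineDerivAt {f' : E → F} {x w : E} {c : F} {C : ℝ}
    (h : ∀ y, HasLineDerivAt ℝ f (f' y) y w)
    (hC : ∀ t ∈ Set.Ico (0 : ℝ) 1, ‖f' (x + t • w) - c‖ ≤ C) :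
    ‖f (x + w) - f x - c‖ ≤ C := by
  have hd : ∀ t : ℝ, HasDerivAt (fun s : ℝ => f (x + s • w) - s • c) (f' (x + t • w) - c) t := by
    intro t
    simpa using (hasDerivAt_comp_line (h _)).fun_sub ((hasDerivAt_id t).smul_const c)
  have := norm_image_sub_le_of_norm_deriv_le_segment_01'
    (fun t _ => (hd t).hasDerivWithinAt) hC
  simpa [sub_right_comm] using this

theorem hasLineDerivAt_add_direction {x v w : E} {a : F} {f' : E → F}
    (hv : HasLineDerivAt ℝ f a x v) (hw : ∀ y, HasLineDerivAt ℝ f (f' y) y w)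
    (hf' : ContinuousAt f' x) : HasLineDerivAt ℝ f (a + f' x) x (v + w) := by
  have hstep : HasDerivAt (fun t : ℝ => f (x + t • v + t • w) - f (x + t • v)) (f' x) 0 := by
    rw [hasDerivAt_iff_isLittleO, Asymptotics.isLittleO_iff]
    intro ε hε
    obtain ⟨δ, hδ, hball⟩ := Metric.continuousAt_iff.1 hf' ε hε
    have hsmall : ∀ᶠ t : ℝ in 𝓝 0, |t| * (‖v‖ + ‖w‖) < δ := by
      refine Tendsto.eventually_lt_const hδ ?_
      have : Continuous fun t : ℝ => |t| * (‖v‖ + ‖w‖) := by fun_prop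
      simpa using this.tendsto 0
    filter_upwards [hsmall] with t ht
    have hmv : ‖f (x + t • v + t • w) - f (x + t • v) - t • f' x‖ ≤ |t| * ε := by
      refine norm_sub_sub_le_of_hasLineDerivAt (fun y => (hw y).smul t) fun s hs => ?_
      rw [← smul_sub, norm_smul, Real.norm_eq_abs]
      gcongr
      rw [← dist_eq_norm]
      refine (hball (lt_of_le_of_lt ?_ ht)).le
      calc dist (x + t • v + s • t • w) x = ‖t • v + s • t • w‖ := by
            rw [dist_eq_norm, add_assoc, add_sub_cancel_left]
        _ ≤ |t| * ‖v‖ + s * (|t| * ‖w‖) := by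
            refine (norm_add_le _ _).trans_eq ?_
            simp only [norm_smul, Real.norm_eq_abs, abs_of_nonneg hs.1]
        _ ≤ |t| * ‖v‖ + 1 * (|t| * ‖w‖) := by gcongr; exact hs.2.le
        _ = |t| * (‖v‖ + ‖w‖) := by ring
    simpa [mul_comm] using hmv
  have := HasDerivAt.add (show HasDerivAt (fun t : ℝ => f (x + t • v)) a 0 from hv) hstep
  refine this.congr_of_eventuallyEq (.of_forall fun t => ?_)
  simp [add_assoc]

theorem hasFDerivAt_of_continuous_lineDeriv {f' : E → E →L[ℝ] F}
    (h : ∀ x w, HasLineDerivAt ℝ f (f' x w) x w) (hf' : Continuous f') (x : E) :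
    HasFDerivAt f (f' x) x := by
  rw [hasFDerivAt_iff_isLittleO_nhds_zero, Asymptotics.isLittleO_iff]
  intro ε hε
  obtain ⟨δ, hδ, hball⟩ := Metric.continuousAt_iff.1 hf'.continuousAt ε hε
  filter_upwards [Metric.ball_mem_nhds (0 : E) hδ] with w hw
  refine norm_sub_sub_le_of_hasLineDerivAt (fun y => h y w) fun t ht => ?_
  rw [← sub_apply]
  refine ContinuousLinearMap.le_of_opNorm_le _ ?_ w
  rw [← dist_eq_norm]
  refine (hball ?_).le
  rw [dist_eq_norm, add_sub_cancel_left, norm_smul, Real.norm_eq_abs, abs_of_nonneg ht.1]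
  exact (mul_le_of_le_one_left (norm_nonneg w) ht.2.le).trans_lt (by simpa using hw)

theorem differentiable_of_continuous_lineDeriv [FiniteDimensional ℝ E]
    (h : ∀ w, ∃ f' : E → F, Continuous f' ∧ ∀ x, HasLineDerivAt ℝ f (f' x) x w) :
    Differentiable ℝ f := by
  choose f' hc hf' using h
  let D : E → E →L[ℝ] F := fun x => LinearMap.toContinuousLinearMap
    { toFun := fun w => f' w x
      map_add' := fun v w =>
        (hf' (v + w) x).unique (hasLineDerivAt_add_direction (hf' v x) (hf' w) (hc w).continuousAt)
      map_smul' := fun r w => (hf' (r • w) x).unique ((hf' w x).smul r) }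
  exact fun x => (hasFDerivAt_of_continuous_lineDeriv (f' := D) (fun x w => hf' w x)
    (continuous_clm_apply.2 hc) x).differentiableAt

end LineDerivatives

section Criterion

/-- The function `f` is (the underlying function of) a Schwartz function. -/
def IsSchwartz {E F : Type*} [NormedAddCommGroup E] [NormedSpace ℝ E] [NormedAddCommGroup F]
    [NormedSpace ℝ F] (f : E → F) : Prop :=
  ∃ g : 𝓢(E, F), ⇑g = f

variable {E F : Type*} [NormedAddCommGroup E] [NormedSpace ℝ E] [FiniteDimensional ℝ E]
  [NormedAddCommGroup F] [NormedSpace ℝ F] {𝒞 : Set (E → F)}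

theorem contDiff_of_lineDeriv_mem (hc : ∀ g ∈ 𝒞, Continuous g)
    (hd : ∀ g ∈ 𝒞, ∀ w, ∃ g' ∈ 𝒞, ∀ x, HasLineDerivAt ℝ g (g' x) x w) (n : ℕ) :
    ∀ g ∈ 𝒞, ContDiff ℝ n g := by
  induction n with
  | zero => exact fun g hg => contDiff_zero.2 (hc g hg)
  | succ n ih =>
    intro g hg
    have hg' : Differentiable ℝ g := differentiable_of_continuous_lineDeriv fun w =>
      let ⟨g', h, hw⟩ := hd g hg w
      ⟨g', hc g' h, hw⟩
    refine mod_cast (contDiff_succ_iff_fderiv_apply (𝕜 := ℝ) (n := n)).2 ⟨hg', by simp, fun w => ?_⟩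
    obtain ⟨g', h, hw⟩ := hd g hg w
    convert ih g' h using 1
    funext x
    exact ((hg' x).hasFDerivAt.hasLineDerivAt w).unique (hw x)

theorem exists_pow_mul_norm_le_of_linear_mul_mem (hb : ∀ g ∈ 𝒞, ∃ C, ∀ x, ‖g x‖ ≤ C)
    (hm : ∀ g ∈ 𝒞, ∀ ℓ : E →L[ℝ] ℝ, (fun x => ℓ x • g x) ∈ 𝒞) (k : ℕ) :
    ∀ g ∈ 𝒞, ∃ C, ∀ x, ‖x‖ ^ k * ‖g x‖ ≤ C := by
  induction k with
  | zero => simpa using hb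
  | succ k ih =>
    intro g hg
    let b := Module.finBasis ℝ E
    have hx : ∀ x, ‖x‖ ≤ ∑ i, ‖b i‖ * ‖b.coord i x‖ := fun x => by
      conv_lhs => rw [← b.sum_repr x]
      refine norm_sum_le_of_le _ fun i _ => ?_
      rw [norm_smul, mul_comm, Module.Basis.coord_apply]
    choose C hC using fun i => ih _ (hm g hg (LinearMap.toContinuousLinearMap (b.coord i)))
    refine ⟨∑ i, ‖b i‖ * C i, fun x => ?_⟩
    calc ‖x‖ ^ (k + 1) * ‖g x‖ = ‖x‖ * (‖x‖ ^ k * ‖g x‖) := by ring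
      _ ≤ (∑ i, ‖b i‖ * ‖b.coord i x‖) * (‖x‖ ^ k * ‖g x‖) := by gcongr; exact hx x
      _ = ∑ i, ‖b i‖ * (‖x‖ ^ k * (‖b.coord i x‖ * ‖g x‖)) := by
        rw [Finset.sum_mul]
        exact Finset.sum_congr rfl fun i _ => by ring
      _ ≤ ∑ i, ‖b i‖ * C i := by
        gcongr with i
        simpa [norm_smul] using hC i x

theorem exists_pow_mul_norm_iteratedFDeriv_succ_le {g : E → F} {k n : ℕ}
    (hg : ContDiff ℝ (n + 1) g)
    (h : ∀ w, ∃ C, ∀ x, ‖x‖ ^ k * ‖iteratedFDeriv ℝ n (fun x => fderiv ℝ g x w) x‖ ≤ C) :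
    ∃ C, ∀ x, ‖x‖ ^ k * ‖iteratedFDeriv ℝ (n + 1) g x‖ ≤ C := by
  let b := Module.finBasis ℝ E
  let Λ : Fin (Module.finrank ℝ E) → F →L[ℝ] (E →L[ℝ] F) := fun i =>
    ContinuousLinearMap.smulRightL ℝ E F (LinearMap.toContinuousLinearMap (b.coord i))
  have hfderiv : fderiv ℝ g = fun x => ∑ i, (Λ i ∘ fun x => fderiv ℝ g x (b i)) x := by
    funext x
    ext v
    conv_lhs => rw [← b.sum_repr v, map_sum]
    simp [Λ]
  have hcd : ∀ i, ContDiff ℝ n fun x => fderiv ℝ g x (b i) := fun i =>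
    (hg.fderiv_right le_rfl).clm_apply contDiff_const
  choose C hC using fun i => h (b i)
  refine ⟨∑ i, ‖Λ i‖ * C i, fun x => ?_⟩
  rw [← norm_iteratedFDeriv_fderiv, hfderiv,
    iteratedFDeriv_sum fun i _ => (Λ i).contDiff.comp (hcd i), Finset.sum_apply]
  calc _ ≤ ‖x‖ ^ k * ∑ i, ‖Λ i‖ * ‖iteratedFDeriv ℝ n (fun x => fderiv ℝ g x (b i)) x‖ := by
        gcongr
        exact norm_sum_le_of_le _ fun i _ =>
          (Λ i).norm_iteratedFDeriv_comp_left (hcd i).contDiffAt le_rfl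
    _ = ∑ i, ‖Λ i‖ * (‖x‖ ^ k * ‖iteratedFDeriv ℝ n (fun x => fderiv ℝ g x (b i)) x‖) := by
        rw [Finset.mul_sum]
        exact Finset.sum_congr rfl fun i _ => by ring
    _ ≤ _ := by
        gcongr with i
        exact hC i x

theorem isSchwartz_of_mem_class (hc : ∀ g ∈ 𝒞, Continuous g) (hb : ∀ g ∈ 𝒞, ∃ C, ∀ x, ‖g x‖ ≤ C)
    (hm : ∀ g ∈ 𝒞, ∀ ℓ : E →L[ℝ] ℝ, (fun x => ℓ x • g x) ∈ 𝒞)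
    (hd : ∀ g ∈ 𝒞, ∀ w, ∃ g' ∈ 𝒞, ∀ x, HasLineDerivAt ℝ g (g' x) x w)
    {g : E → F} (hg : g ∈ 𝒞) : IsSchwartz g := by
  have hs : ∀ (n : ℕ), ∀ g ∈ 𝒞, ContDiff ℝ n g := contDiff_of_lineDeriv_mem hc hd
  have decay : ∀ k n : ℕ, ∀ g ∈ 𝒞, ∃ C, ∀ x, ‖x‖ ^ k * ‖iteratedFDeriv ℝ n g x‖ ≤ C := by
    intro k n
    induction n with
    | zero => simpa using exists_pow_mul_norm_le_of_linear_mul_mem hb hm k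
    | succ n ih =>
      intro g hg
      refine exists_pow_mul_norm_iteratedFDeriv_succ_le (mod_cast hs (n + 1) g hg) fun w => ?_
      obtain ⟨g', hg', hw⟩ := hd g hg w
      convert ih g' hg' using 7 with C x
      funext x
      exact (((hs 1 g hg).differentiable (by simp) x).hasFDerivAt.hasLineDerivAt w).unique (hw x)
  exact ⟨⟨g, contDiff_infty.2 fun n => hs n g hg, fun k n => decay k n g hg⟩, rfl⟩

end Criterion

/-! ### Tensor products and partial Fourier integrals -/

namespace IsSchwartz

variable {D E F : Type*} [NormedAddCommGroup D] [NormedSpace ℝ D] [NormedAddCommGroup E]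
  [NormedSpace ℝ E] [NormedAddCommGroup F] [NormedSpace ℝ F]

theorem comp_injective [FiniteDimensional ℝ D] {f : E → F} (hf : IsSchwartz f) {A : D →ₗ[ℝ] E}
    (hA : Function.Injective A) : IsSchwartz fun x => f (A x) := by
  obtain ⟨f, rfl⟩ := hf
  obtain ⟨K, -, hK⟩ := A.exists_antilipschitzWith (LinearMap.ker_eq_bot.2 hA)
  exact ⟨SchwartzMap.compCLMOfAntilipschitz ℝ
    (LinearMap.toContinuousLinearMap A).hasTemperateGrowth hK f, rfl⟩

theorem temperate_mul {u f : E → ℂ} (hu : u.HasTemperateGrowth) (hf : IsSchwartz f) :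
    IsSchwartz fun x => u x * f x := by
  obtain ⟨f, rfl⟩ := hf
  exact ⟨SchwartzMap.smulLeftCLM ℂ u f, funext fun x => by
    simp [SchwartzMap.smulLeftCLM_apply_apply hu]⟩

theorem conj {f : E → ℂ} (hf : IsSchwartz f) : IsSchwartz fun x => (starRingEnd ℂ) (f x) := by
  obtain ⟨f, rfl⟩ := hf
  exact ⟨SchwartzMap.postcompCLM (𝕜 := ℝ) (Complex.conjCLE : ℂ →L[ℝ] ℂ) f, rfl⟩

end IsSchwartz

section Tensor

variable {D E F : Type*} [NormedAddCommGroup D] [NormedSpace ℝ D] [NormedAddCommGroup E]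
  [NormedSpace ℝ E] [NormedAddCommGroup F] [NormedSpace ℝ F]

theorem norm_iteratedFDeriv_comp_clm_le (f : 𝓢(E, ℂ)) {A : D →L[ℝ] E} (hA : ‖A‖ ≤ 1) (n : ℕ)
    (x : D) : ‖iteratedFDeriv ℝ n (f ∘ A) x‖ ≤ ‖iteratedFDeriv ℝ n f (A x)‖ := by
  rw [A.iteratedFDeriv_comp_right (f.smooth n) x le_rfl]
  refine (ContinuousMultilinearMap.norm_compContinuousLinearMap_le _ _).trans ?_
  rw [Finset.prod_const, Finset.card_univ, Fintype.card_fin]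
  exact mul_le_of_le_one_right (norm_nonneg _) (pow_le_one₀ (norm_nonneg _) hA)

theorem exists_pow_mul_norm_iteratedFDeriv_mul_le (f : 𝓢(E, ℂ)) (g : 𝓢(F, ℂ)) (k i j : ℕ) :
    ∃ C, ∀ z : E × F,
      ‖z‖ ^ k * (‖iteratedFDeriv ℝ i f z.1‖ * ‖iteratedFDeriv ℝ j g z.2‖) ≤ C := by
  refine ⟨SchwartzMap.seminorm ℝ k i f * SchwartzMap.seminorm ℝ 0 j g +
    SchwartzMap.seminorm ℝ 0 i f * SchwartzMap.seminorm ℝ k j g, fun z => ?_⟩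
  have hz : ‖z‖ ^ k ≤ ‖z.1‖ ^ k + ‖z.2‖ ^ k := by
    rcases max_choice ‖z.1‖ ‖z.2‖ with h | h <;> rw [Prod.norm_def, h]
    · exact le_add_of_nonneg_right (by positivity)
    · exact le_add_of_nonneg_left (by positivity)
  have hf := fun m => f.le_seminorm ℝ m i z.1
  have hg := fun m => g.le_seminorm ℝ m j z.2
  calc _ ≤ (‖z.1‖ ^ k + ‖z.2‖ ^ k) *
          (‖iteratedFDeriv ℝ i f z.1‖ * ‖iteratedFDeriv ℝ j g z.2‖) := by gcongr
    _ = (‖z.1‖ ^ k * ‖iteratedFDeriv ℝ i f z.1‖) * (‖z.2‖ ^ 0 * ‖iteratedFDeriv ℝ j g z.2‖) +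
          (‖z.1‖ ^ 0 * ‖iteratedFDeriv ℝ i f z.1‖) * (‖z.2‖ ^ k * ‖iteratedFDeriv ℝ j g z.2‖) := by
        ring
    _ ≤ _ := by
        gcongr
        · exact hf k
        · exact hg 0
        · exact hf 0
        · exact hg k

theorem IsSchwartz.tensor {f : E → ℂ} {g : F → ℂ} (hf : IsSchwartz f) (hg : IsSchwartz g) :
    IsSchwartz fun z : E × F => f z.1 * g z.2 := by
  obtain ⟨f, rfl⟩ := hf
  obtain ⟨g, rfl⟩ := hg
  have hf₁ : ∀ n : ℕ, ContDiff ℝ n (f ∘ ContinuousLinearMap.fst ℝ E F) := fun n =>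
    (f.smooth n).comp (ContinuousLinearMap.contDiff _)
  have hg₂ : ∀ n : ℕ, ContDiff ℝ n (g ∘ ContinuousLinearMap.snd ℝ E F) := fun n =>
    (g.smooth n).comp (ContinuousLinearMap.contDiff _)
  refine ⟨⟨_, contDiff_infty.2 fun n => (hf₁ n).mul (hg₂ n), fun k n => ?_⟩, rfl⟩
  choose C hC using fun i => exists_pow_mul_norm_iteratedFDeriv_mul_le f g k i (n - i)
  refine ⟨∑ i ∈ Finset.range (n + 1), (n.choose i : ℝ) * C i, fun z => ?_⟩
  have hmul := norm_iteratedFDeriv_mul_le (hf₁ n) (hg₂ n) z le_rfl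
  have hfst := fun i =>
    norm_iteratedFDeriv_comp_clm_le f (ContinuousLinearMap.norm_fst_le ℝ E F) i z
  have hsnd := fun i =>
    norm_iteratedFDeriv_comp_clm_le g (ContinuousLinearMap.norm_snd_le ℝ E F) i z
  calc _ ≤ _ := mul_le_mul_of_nonneg_left hmul (pow_nonneg (norm_nonneg z) k)
    _ ≤ ‖z‖ ^ k * ∑ i ∈ Finset.range (n + 1), (n.choose i : ℝ) *
          ‖iteratedFDeriv ℝ i f z.1‖ * ‖iteratedFDeriv ℝ (n - i) g z.2‖ := by
        gcongr with i
        · exact hfst i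
        · exact hsnd (n - i)
    _ = ∑ i ∈ Finset.range (n + 1), (n.choose i : ℝ) * (‖z‖ ^ k *
          (‖iteratedFDeriv ℝ i f z.1‖ * ‖iteratedFDeriv ℝ (n - i) g z.2‖)) := by
        rw [Finset.mul_sum]
        exact Finset.sum_congr rfl fun i _ => by ring
    _ ≤ _ := Finset.sum_le_sum fun i _ =>
        mul_le_mul_of_nonneg_left (hC i z) (Nat.cast_nonneg _)

end Tensor

section PartialFourier

variable {M V F P : Type*} [NormedAddCommGroup M] [NormedSpace ℝ M]
  [NormedAddCommGroup V] [NormedSpace ℝ V] [NormedAddCommGroup F] [NormedSpace ℝ F]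
  [NormedAddCommGroup P] [NormedSpace ℝ P]

theorem exists_integrable_majorant [MeasurableSpace M] (μ : Measure M)
    [μ.HasTemperateGrowth] (f : 𝓢(M × V, F)) :
    ∃ b : M → ℝ, Integrable b μ ∧ ∀ y v, ‖f (y, v)‖ ≤ b y := by
  let l := μ.integrablePower
  refine ⟨fun y => 2 ^ l * ((Finset.Iic (l, 0)).sup fun m => SchwartzMap.seminorm ℝ m.1 m.2) f *
    (1 + ‖y‖) ^ (-(l : ℝ)), (Measure.integrable_pow_neg_integrablePower μ).const_mul _,
    fun y v => ?_⟩
  have h := SchwartzMap.one_add_le_sup_seminorm_apply (𝕜 := ℝ) (m := (l, 0)) le_rfl le_rfl f (y, v)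
  rw [norm_iteratedFDeriv_zero] at h
  have hy : ‖y‖ ≤ ‖(y, v)‖ := le_max_left _ _
  beta_reduce
  rw [Real.rpow_neg (by positivity), Real.rpow_natCast, ← div_eq_mul_inv,
    le_div_iff₀ (by positivity), mul_comm]
  exact le_trans (by gcongr) h

/-- Multiplication of a Schwartz function by a linear functional. -/
def linearMul {E : Type*} [NormedAddCommGroup E] [NormedSpace ℝ E] (ℓ : E →L[ℝ] ℝ) :
    𝓢(E, ℂ) →L[ℂ] 𝓢(E, ℂ) :=
  SchwartzMap.smulLeftCLM ℂ fun x => (ℓ x : ℂ)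

theorem linearMul_apply {E : Type*} [NormedAddCommGroup E] [NormedSpace ℝ E] (ℓ : E →L[ℝ] ℝ)
    (f : 𝓢(E, ℂ)) (x : E) : linearMul ℓ f x = ℓ x * f x := by
  have h : (fun x => (ℓ x : ℂ)).HasTemperateGrowth :=
    (Complex.ofRealCLM ∘L ℓ).hasTemperateGrowth
  simp [linearMul, SchwartzMap.smulLeftCLM_apply_apply h]

theorem norm_cexp_I_mul_ofReal (t : ℝ) : ‖Complex.exp (Complex.I * t)‖ = 1 := by
  rw [mul_comm, Complex.norm_exp_ofReal_mul_I]

/-- The partial Fourier integral `(p, v) ↦ ∫ exp (i B(y, p)) f(y, v) dμ(y)` of a Schwartz function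
with respect to a pairing `B` of the integration variable with the frequency `p`. -/
def partialFourier [MeasurableSpace M] (μ : Measure M) (B : M →L[ℝ] P →L[ℝ] ℝ)
    (f : 𝓢(M × V, ℂ)) (z : P × V) : ℂ :=
  ∫ y, Complex.exp (Complex.I * (B y z.1 : ℂ)) * f (y, z.2) ∂μ

/-- The Schwartz function whose partial Fourier integral is the derivative of that of `f` in the
direction `w`. -/
def partialFourierDeriv (B : M →L[ℝ] P →L[ℝ] ℝ) (w : P × V) (f : 𝓢(M × V, ℂ)) : 𝓢(M × V, ℂ) :=
  Complex.I • linearMul (B.flip w.1 ∘L ContinuousLinearMap.fst ℝ M V) f + ∂_{((0 : M), w.2)} f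

theorem hasLineDerivAt_phase_mul (B : M →L[ℝ] P →L[ℝ] ℝ) (f : 𝓢(M × V, ℂ)) (y : M) (z w : P × V) :
    HasLineDerivAt ℝ (fun z : P × V => Complex.exp (Complex.I * (B y z.1 : ℂ)) * f (y, z.2))
      (Complex.exp (Complex.I * (B y z.1 : ℂ)) * partialFourierDeriv B w f (y, z.2)) z w := by
  have hphase : HasLineDerivAt ℝ (fun z : P × V => Complex.exp (Complex.I * (B y z.1 : ℂ)))
      (Complex.exp (Complex.I * (B y z.1 : ℂ)) * (Complex.I * (B y w.1 : ℂ))) z w := by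
    have h : HasFDerivAt (fun z : P × V => (B y z.1 : ℂ))
        (Complex.ofRealCLM ∘L B y ∘L ContinuousLinearMap.fst ℝ P V) z :=
      (Complex.ofRealCLM ∘L B y ∘L ContinuousLinearMap.fst ℝ P V).hasFDerivAt
    simpa using (h.const_mul Complex.I).cexp.hasLineDerivAt w
  have hf : HasLineDerivAt ℝ (fun z : P × V => f (y, z.2))
      ((∂_{((0 : M), w.2)} f) (y, z.2)) z w := by
    simpa [HasLineDerivAt, SchwartzMap.lineDerivOp_apply_eq_fderiv] using
      (f.hasFDerivAt (y, z.2)).hasLineDerivAt ((0 : M), w.2)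
  refine (HasDerivAt.mul hphase hf).congr_deriv ?_
  simp only [zero_smul, add_zero, partialFourierDeriv, add_apply, smul_apply, linearMul_apply,
    ContinuousLinearMap.comp_apply, ContinuousLinearMap.coe_fst', ContinuousLinearMap.flip_apply,
    smul_eq_mul]
  ring

variable [MeasurableSpace M] [BorelSpace M] [FiniteDimensional ℝ M] (μ : Measure M)
  [μ.IsAddHaarMeasure] (B : M →L[ℝ] P →L[ℝ] ℝ) (f : 𝓢(M × V, ℂ))

theorem integrable_phase_mul (p : P) (v : V) :
    Integrable (fun y => Complex.exp (Complex.I * (B y p : ℂ)) * f (y, v)) μ := by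
  obtain ⟨b, hb, hfb⟩ := exists_integrable_majorant μ f
  have := f.continuous
  refine hb.mono' (Continuous.aestronglyMeasurable (by fun_prop)) (.of_forall fun y => ?_)
  rw [norm_mul, norm_cexp_I_mul_ofReal, one_mul]
  exact hfb y v

theorem exists_norm_partialFourier_le : ∃ C, ∀ z, ‖partialFourier μ B f z‖ ≤ C := by
  obtain ⟨b, hb, hfb⟩ := exists_integrable_majorant μ f
  refine ⟨∫ y, b y ∂μ, fun z => norm_integral_le_of_norm_le hb (.of_forall fun y => ?_)⟩
  rw [norm_mul, norm_cexp_I_mul_ofReal, one_mul]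
  exact hfb y z.2

theorem continuous_partialFourier : Continuous (partialFourier μ B f) := by
  obtain ⟨b, hb, hfb⟩ := exists_integrable_majorant μ f
  have := f.continuous
  refine continuous_of_dominated (fun z => (integrable_phase_mul μ B f z.1 z.2).1)
    (fun z => .of_forall fun y => ?_) hb (.of_forall fun y => by fun_prop)
  rw [norm_mul, norm_cexp_I_mul_ofReal, one_mul]
  exact hfb y z.2

theorem hasLineDerivAt_partialFourier (z w : P × V) :
    HasLineDerivAt ℝ (partialFourier μ B f) (partialFourier μ B (partialFourierDeriv B w f) z)
      z w := by
  obtain ⟨b, hb, hfb⟩ := exists_integrable_majorant μ (partialFourierDeriv B w f)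
  have h := hasDerivAt_integral_of_dominated_loc_of_deriv_le (μ := μ) (x₀ := (0 : ℝ))
    (F := fun t y => Complex.exp (Complex.I * (B y (z + t • w).1 : ℂ)) * f (y, (z + t • w).2))
    (F' := fun t y => Complex.exp (Complex.I * (B y (z + t • w).1 : ℂ)) *
      partialFourierDeriv B w f (y, (z + t • w).2))
    univ_mem (.of_forall fun t => (integrable_phase_mul μ B f _ _).1)
    (integrable_phase_mul μ B f _ _) (integrable_phase_mul μ B _ _ _).1
    (.of_forall fun y t _ => ?_) hb
    (.of_forall fun y t _ => hasDerivAt_comp_line (hasLineDerivAt_phase_mul B f y _ w))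
  · exact h.2.congr_deriv (by simp [partialFourier])
  · rw [norm_mul, norm_cexp_I_mul_ofReal, one_mul]
    exact hfb y _

theorem linear_mul_partialFourier (y₀ : M) (z : P × V) :
    B y₀ z.1 * partialFourier μ B f z =
      partialFourier μ B (Complex.I • ∂_{(y₀, (0 : V))} f) z := by
  have hphase : ∀ y, HasLineDerivAt ℝ (fun y => Complex.exp (Complex.I * (B y z.1 : ℂ)))
      (Complex.I * (B y₀ z.1 : ℂ) * Complex.exp (Complex.I * (B y z.1 : ℂ))) y y₀ := fun y => by
    have h : HasFDerivAt (fun y => (B y z.1 : ℂ)) (Complex.ofRealCLM ∘L B.flip z.1) y :=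
      (Complex.ofRealCLM ∘L B.flip z.1).hasFDerivAt
    simpa [mul_comm] using (h.const_mul Complex.I).cexp.hasLineDerivAt y₀
  have hf : ∀ y, HasLineDerivAt ℝ (fun y => f (y, z.2)) ((∂_{(y₀, (0 : V))} f) (y, z.2)) y y₀ :=
    fun y => by simpa [HasLineDerivAt, SchwartzMap.lineDerivOp_apply_eq_fderiv] using
      (f.hasFDerivAt (y, z.2)).hasLineDerivAt (y₀, (0 : V))
  have hint := integrable_phase_mul μ B f z.1 z.2
  have hparts := integral_bilinear_hasLineDerivAt_right_eq_neg_left_of_integrable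
    (B := ContinuousLinearMap.mul ℝ ℂ) (μ := μ)
    (by simpa [mul_assoc] using hint.const_mul (Complex.I * (B y₀ z.1 : ℂ)))
    (by simpa using integrable_phase_mul μ B (∂_{(y₀, (0 : V))} f) z.1 z.2) (by simpa using hint)
    (fun y _ => hphase y) (fun y _ => hf y)
  simp only [ContinuousLinearMap.mul_apply', mul_assoc, integral_const_mul] at hparts
  simp only [partialFourier, smul_apply, smul_eq_mul, mul_left_comm _ Complex.I,
    integral_const_mul, hparts]
  linear_combination ((B y₀ z.1 : ℂ) *
    ∫ y, Complex.exp (Complex.I * (B y z.1 : ℂ)) * f (y, z.2) ∂μ) * Complex.I_mul_I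

theorem partialFourier_add (g : 𝓢(M × V, ℂ)) :
    partialFourier μ B (f + g) = partialFourier μ B f + partialFourier μ B g := by
  funext z
  simp only [partialFourier, Pi.add_apply, add_apply, mul_add]
  exact integral_add (integrable_phase_mul μ B f _ _) (integrable_phase_mul μ B g _ _)

variable {B} [FiniteDimensional ℝ P] [FiniteDimensional ℝ V]

theorem isSchwartz_partialFourier (hB : Function.Surjective B) :
    IsSchwartz (partialFourier μ B f) := by
  refine isSchwartz_of_mem_class (𝒞 := Set.range (partialFourier (V := V) μ B)) ?_ ?_ ?_ ?_ ⟨f, rfl⟩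
  · rintro _ ⟨f, rfl⟩
    exact continuous_partialFourier μ B f
  · rintro _ ⟨f, rfl⟩
    exact exists_norm_partialFourier_le μ B f
  · rintro _ ⟨f, rfl⟩ ℓ
    obtain ⟨y₀, hy₀⟩ := hB (ℓ ∘L ContinuousLinearMap.inl ℝ P V)
    let ℓV := ℓ ∘L ContinuousLinearMap.inr ℝ P V ∘L ContinuousLinearMap.snd ℝ M V
    refine ⟨Complex.I • ∂_{(y₀, (0 : V))} f + linearMul ℓV f, funext fun z => ?_⟩
    have hz : ℓ z = B y₀ z.1 + ℓ (0, z.2) := by simp [hy₀, ← map_add]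
    rw [Complex.real_smul, partialFourier_add, Pi.add_apply, ← linear_mul_partialFourier, hz]
    simp only [partialFourier, linearMul_apply, ℓV, ContinuousLinearMap.comp_apply,
      ContinuousLinearMap.coe_snd', ContinuousLinearMap.inr_apply, mul_left_comm _ (ℓ _ : ℂ),
      integral_const_mul]
    push_cast
    ring
  · rintro _ ⟨f, rfl⟩ w
    exact ⟨_, ⟨partialFourierDeriv B w f, rfl⟩, fun z => hasLineDerivAt_partialFourier μ B f z w⟩

end PartialFourier

/-! ### Complementary planes and Fourier inversion -/

section ChangeOfVariables

variable {E F : Type*} [NormedAddCommGroup E] [NormedSpace ℝ E] [MeasurableSpace E] [BorelSpace E]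
  [NormedAddCommGroup F] [NormedSpace ℝ F] [FiniteDimensional ℝ F] [MeasurableSpace F]
  [BorelSpace F]

theorem exists_integral_comp_linearEquiv (μ : Measure E) [μ.IsAddHaarMeasure] (ν : Measure F)
    [ν.IsAddHaarMeasure] (e : E ≃L[ℝ] F) :
    ∃ c : ℝ, 0 < c ∧ (∀ h : F → ℂ, Integrable h ν → Integrable (fun x => h (e x)) μ) ∧
      ∀ h : F → ℂ, ∫ x, h (e x) ∂μ = c * ∫ y, h y ∂ν := by
  have := FiniteDimensional.proper_real F
  have hmap := Measure.isAddLeftInvariant_eq_smul (μ.map e) ν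
  have hc := Measure.addHaarScalarFactor_pos_of_isAddHaarMeasure (μ.map e) ν
  set c := (μ.map e).addHaarScalarFactor ν
  have he : MeasurableEmbedding e := e.toHomeomorph.measurableEmbedding
  refine ⟨c, NNReal.coe_pos.2 hc, fun h hh => he.integrable_map_iff.1 ?_, fun h => ?_⟩
  · rw [hmap]
    exact hh.smul_measure_nnreal
  · rw [← he.integral_map, hmap, integral_smul_nnreal_measure]
    rfl

end ChangeOfVariables

section FourierInversion

open scoped FourierTransform

variable {E F H : Type*} [NormedAddCommGroup E] [NormedSpace ℝ E] [FiniteDimensional ℝ E]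
  [NormedAddCommGroup F] [NormedSpace ℝ F] [FiniteDimensional ℝ F]
  [NormedAddCommGroup H] [InnerProductSpace ℝ H] [FiniteDimensional ℝ H]

theorem exists_continuousLinearEquiv_inner_eq {B : E →L[ℝ] H →L[ℝ] ℝ} (hB : Function.Injective B)
    (hdim : Module.finrank ℝ E = Module.finrank ℝ H) :
    ∃ a : E ≃L[ℝ] H, ∀ x v, inner ℝ v (a x) = B x v := by
  let a : E →ₗ[ℝ] H :=
    { toFun := fun x => (InnerProductSpace.toDual ℝ H).symm (B x)
      map_add' := fun x y => by rw [map_add, map_add]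
      map_smul' := fun r x => by
        rw [map_smul, LinearIsometryEquiv.map_smulₛₗ, conj_trivial, RingHom.id_apply] }
  have ha : Function.Injective a := (InnerProductSpace.toDual ℝ H).symm.injective.comp hB
  refine ⟨(LinearEquiv.ofInjectiveOfFinrankEq a ha hdim).toContinuousLinearEquiv, fun x v => ?_⟩
  rw [real_inner_comm]
  exact InnerProductSpace.toDual_symm_apply

variable [MeasurableSpace F] [BorelSpace F]

theorem integral_fourier_eq_apply_zero [MeasurableSpace H] [BorelSpace H] (f : 𝓢(H, ℂ)) :
    ∫ w, (𝓕 f) w = f 0 := by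
  have h : (𝓕⁻ (𝓕 f)) 0 = f 0 := by rw [FourierTransform.fourierInv_fourier_eq f]
  rw [← h, SchwartzMap.fourierInv_coe, Real.fourierInv_eq']
  simp

theorem exists_integral_cexp_eq_fourier (σ : Measure F) [σ.IsAddHaarMeasure]
    {B : E →L[ℝ] F →L[ℝ] ℝ} (hB : Function.Injective B)
    (hdim : Module.finrank ℝ E = Module.finrank ℝ F) :
    ∃ (c : ℝ) (a : E ≃L[ℝ] EuclideanSpace ℝ (Fin (Module.finrank ℝ F)))
      (e : F ≃L[ℝ] EuclideanSpace ℝ (Fin (Module.finrank ℝ F))), 0 < c ∧ ∀ (ρ : 𝓢(F, ℂ)) (x : E),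
        ∫ y, ρ y * Complex.exp (Complex.I * (B x y : ℂ)) ∂σ =
          c * 𝓕 (SchwartzMap.compCLMOfContinuousLinearEquiv ℝ e.symm ρ) (a x) := by
  let e : F ≃L[ℝ] EuclideanSpace ℝ (Fin (Module.finrank ℝ F)) :=
    ContinuousLinearEquiv.ofFinrankEq (by simp)
  -- The sign and the factor `2π` of the Fourier transform are absorbed into the pairing.
  let B' : E →L[ℝ] EuclideanSpace ℝ (Fin (Module.finrank ℝ F)) →L[ℝ] ℝ :=
    (-(2 * Real.pi)⁻¹) • B.bilinearComp (ContinuousLinearMap.id ℝ E) (e.symm : _ →L[ℝ] F)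
  have hB' : Function.Injective B' := fun x x' h => hB <| ContinuousLinearMap.ext fun y => by
    simpa [B', Real.pi_ne_zero] using DFunLike.congr_fun h (e y)
  obtain ⟨a, ha⟩ := exists_continuousLinearEquiv_inner_eq hB' (by simpa using hdim)
  obtain ⟨c, hc, -, he⟩ := exists_integral_comp_linearEquiv σ volume e
  refine ⟨c, a, e, hc, fun ρ x => ?_⟩
  have h := he fun v => ρ (e.symm v) * Complex.exp (Complex.I * (B x (e.symm v) : ℂ))
  simp only [e.symm_apply_apply] at h
  rw [h, SchwartzMap.fourier_coe, Real.fourier_eq']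
  congr 2
  funext v
  rw [ha, smul_eq_mul, mul_comm]
  congr 2
  simp only [B', smul_apply, ContinuousLinearMap.bilinearComp_apply,
    ContinuousLinearMap.coe_id', id_eq, smul_eq_mul]
  push_cast
  field_simp

theorem exists_fourier_inversion_zero [MeasurableSpace E] [BorelSpace E] (μ : Measure E)
    [μ.IsAddHaarMeasure] (σ : Measure F) [σ.IsAddHaarMeasure]
    {B : E →L[ℝ] F →L[ℝ] ℝ} (hB : Function.Injective B)
    (hdim : Module.finrank ℝ E = Module.finrank ℝ F) :
    ∃ Δ : ℝ, 0 < Δ ∧ ∀ ρ : 𝓢(F, ℂ),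
      (∀ x, Integrable (fun y => ρ y * Complex.exp (Complex.I * (B x y : ℂ))) σ) ∧
      Integrable (fun x => ∫ y, ρ y * Complex.exp (Complex.I * (B x y : ℂ)) ∂σ) μ ∧
      ∫ x, (∫ y, ρ y * Complex.exp (Complex.I * (B x y : ℂ)) ∂σ) ∂μ = ρ 0 * (Δ : ℂ) := by
  obtain ⟨c, a, e, hc, hρ⟩ := exists_integral_cexp_eq_fourier σ hB hdim
  obtain ⟨c', hc', hint, hintegral⟩ := exists_integral_comp_linearEquiv μ volume a
  refine ⟨c * c', mul_pos hc hc', fun ρ => ⟨fun x => ?_, ?_, ?_⟩⟩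
  · refine (ρ.integrable (μ := σ)).mono ?_ (.of_forall fun y => ?_)
    · have := ρ.continuous
      exact Continuous.aestronglyMeasurable (by fun_prop)
    · rw [norm_mul, norm_cexp_I_mul_ofReal, mul_one]
  · simp only [hρ]
    exact (hint _ (SchwartzMap.integrable _)).const_mul _
  · simp only [hρ]
    rw [integral_const_mul, hintegral, integral_fourier_eq_apply_zero]
    simp only [SchwartzMap.compCLMOfContinuousLinearEquiv_apply, Function.comp_apply, map_zero,
      Complex.ofReal_mul]
    ring

end FourierInversion

section Complement

variable {E : Type*} [NormedAddCommGroup E] [NormedSpace ℝ E] [FiniteDimensional ℝ E]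
  {G N M : Submodule ℝ E}

/-- The identification of two complements of `G` along `G`. -/
def complementEquiv (hN : IsCompl G N) (hM : IsCompl G M) : N ≃L[ℝ] M :=
  ((G.quotientEquivOfIsCompl N hN).symm ≪≫ₗ G.quotientEquivOfIsCompl M hM).toContinuousLinearEquiv

theorem projectionOnto_add_complementEquiv (hN : IsCompl G N) (hM : IsCompl G M) (y : N) :
    (G.projectionOnto M hM y : E) + (complementEquiv hN hM y : E) = y :=
  Submodule.projection_add_projection_eq_self hM (y : E)

variable [MeasurableSpace E] [BorelSpace E]

theorem isAddHaarMeasure_map_add (h : IsCompl G N) (σ : Measure G) [σ.IsAddHaarMeasure]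
    (ν : Measure N) [ν.IsAddHaarMeasure] :
    (Measure.map (fun p : G × N => (p.1 : E) + (p.2 : E)) (σ.prod ν)).IsAddHaarMeasure :=
  ((G.prodEquivOfIsCompl N h).toContinuousLinearEquiv).isAddHaarMeasure_map (σ.prod ν)

theorem exists_isAddHaarMeasure_map_add_eq (h : IsCompl G N) (σ : Measure G)
    [σ.IsAddHaarMeasure] (μ : Measure E) [μ.IsAddHaarMeasure] :
    ∃ ν : Measure N, ν.IsAddHaarMeasure ∧
      Measure.map (fun p : G × N => (p.1 : E) + (p.2 : E)) (σ.prod ν) = μ := by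
  have := FiniteDimensional.proper_real E
  let ν₀ : Measure N := Measure.addHaar
  have := isAddHaarMeasure_map_add h σ ν₀
  have hc := Measure.addHaarScalarFactor_pos_of_isAddHaarMeasure μ
    (Measure.map (fun p : G × N => (p.1 : E) + (p.2 : E)) (σ.prod ν₀))
  refine ⟨_, Measure.IsAddHaarMeasure.nnreal_smul ν₀ hc.ne', ?_⟩
  rw [Measure.prod_smul_right, Measure.map_smul]
  exact (Measure.isAddLeftInvariant_eq_smul μ _).symm

theorem eq_of_map_add_eq (σ : Measure G) (μ : Measure E) [μ.IsAddHaarMeasure]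
    (ν ν' : Measure N) [ν.IsAddHaarMeasure] [ν'.IsAddHaarMeasure]
    (hν : Measure.map (fun p : G × N => (p.1 : E) + (p.2 : E)) (σ.prod ν) = μ)
    (hν' : Measure.map (fun p : G × N => (p.1 : E) + (p.2 : E)) (σ.prod ν') = μ) : ν = ν' := by
  have := FiniteDimensional.proper_real E
  have hsmul := Measure.isAddLeftInvariant_eq_smul ν ν'
  set c := ν.addHaarScalarFactor ν'
  rw [hsmul, Measure.prod_smul_right, Measure.map_smul, hν'] at hν
  obtain ⟨K, hK, hK'⟩ := exists_compact_mem_nhds (0 : E)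
  have hcK : (c : ENNReal) * μ K = 1 * μ K := by
    rw [one_mul]
    exact congrArg (fun m : Measure E => m K) hν
  have hc : (c : ENNReal) = 1 :=
    (ENNReal.mul_left_inj (Measure.measure_pos_of_mem_nhds μ hK').ne' hK.measure_lt_top.ne).1 hcK
  rw [hsmul, show c = 1 from mod_cast hc, one_smul]

theorem map_complementEquiv (hN : IsCompl G N) (hM : IsCompl G M) (σ : Measure G)
    [σ.IsAddHaarMeasure] (μ : Measure E) [μ.IsAddHaarMeasure] (ν : Measure N)
    [ν.IsAddHaarMeasure] (ν' : Measure M) [ν'.IsAddHaarMeasure]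
    (hν : Measure.map (fun p : G × N => (p.1 : E) + (p.2 : E)) (σ.prod ν) = μ)
    (hν' : Measure.map (fun p : G × M => (p.1 : E) + (p.2 : E)) (σ.prod ν') = μ) :
    ν.map (complementEquiv hN hM) = ν' := by
  let τ := complementEquiv hN hM
  let g : N →L[ℝ] G := (G.projectionOnto M hM ∘ₗ N.subtype).toContinuousLinearMap
  have hτ : ∀ y : N, (τ y : E) = -g y + y := fun y =>
    eq_neg_add_of_add_eq (projectionOnto_add_complementEquiv hN hM y)
  -- `x + τ y = (x - g y) + y`, and the shear `(x, y) ↦ (x - g y, y)` preserves `σ × ν`.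
  have hshear : MeasurePreserving (fun p : G × N => (-g p.2 + p.1, p.2)) (σ.prod ν) (σ.prod ν) :=
    Measure.measurePreserving_swap.comp <|
      ((MeasurePreserving.id ν).skew_product (g := fun y x => -g y + x)
        (Continuous.measurable (by simp only [Function.uncurry_def]; fun_prop))
        (.of_forall fun y => map_add_left_eq_self σ (-g y))).comp
      (Measure.measurePreserving_swap (μ := σ) (ν := ν))
  have hprod : σ.prod (ν.map τ) = Measure.map (Prod.map id τ) (σ.prod ν) := by
    conv_lhs => rw [← Measure.map_id (μ := σ)]
    exact Measure.map_prod_map σ ν measurable_id τ.continuous.measurable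
  refine eq_of_map_add_eq σ μ _ _ ?_ hν'
  rw [hprod, Measure.map_map (Continuous.measurable (by fun_prop))
    (measurable_id.prodMap τ.continuous.measurable), ← hν]
  conv_rhs => rw [← hshear.map_eq, Measure.map_map (Continuous.measurable (by fun_prop))
    hshear.measurable]
  congr 1
  funext p
  simp only [Function.comp_apply, Prod.map, id_eq, Submodule.coe_add, Submodule.coe_neg, hτ p.2]
  abel

end Complement

section Symplectic

variable {n : ℕ}

/-- The symplectic form as a bilinear form. -/
def sympForm (n : ℕ) : LinearMap.BilinForm ℝ (Phase n) :=
  LinearMap.mk₂ ℝ (symp (n := n))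
    (fun X X' Y => by
      simp only [symp, ← Finset.sum_add_distrib]
      exact Finset.sum_congr rfl fun j _ => by
        simp only [Prod.fst_add, PiLp.add_apply, Prod.snd_add]
        ring)
    (fun c X Y => by
      simp only [symp, Finset.smul_sum]
      exact Finset.sum_congr rfl fun j _ => by
        simp only [Prod.smul_fst, PiLp.smul_apply, smul_eq_mul, Prod.smul_snd]
        ring)
    (fun X Y Y' => by
      simp only [symp, ← Finset.sum_add_distrib]
      exact Finset.sum_congr rfl fun j _ => by
        simp only [Prod.snd_add, PiLp.add_apply, Prod.fst_add]
        ring)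
    (fun c X Y => by
      simp only [symp, Finset.smul_sum]
      exact Finset.sum_congr rfl fun j _ => by
        simp only [Prod.smul_snd, PiLp.smul_apply, smul_eq_mul, Prod.smul_fst]
        ring)

@[simp]
theorem sympForm_apply (X Y : Phase n) : sympForm n X Y = symp X Y := rfl

theorem symp_swap (X Y : Phase n) : symp X Y = -symp Y X := by
  simp only [symp, ← Finset.sum_neg_distrib]
  exact Finset.sum_congr rfl fun j _ => by ring

theorem sympForm_nondegenerate : (sympForm n).Nondegenerate := by
  have hrefl : (sympForm n).IsRefl := fun X Y h => by simpa [symp_swap X Y] using h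
  refine LinearMap.IsRefl.nondegenerate_iff_separatingLeft hrefl |>.2 fun X hX => ?_
  have h := hX (-X.2, X.1)
  simp only [sympForm_apply, symp, PiLp.neg_apply, neg_mul, sub_neg_eq_add,
    Finset.sum_add_distrib, ← sq, ← EuclideanSpace.real_norm_sq_eq] at h
  exact Prod.ext (norm_eq_zero.1 (by nlinarith [sq_nonneg ‖X.1‖, sq_nonneg ‖X.2‖]))
    (norm_eq_zero.1 (by nlinarith [sq_nonneg ‖X.1‖, sq_nonneg ‖X.2‖]))

/-- The symplectic orthogonal complement `L^ω` of a plane. -/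
def sympOrth (L : Submodule ℝ (Phase n)) : Submodule ℝ (Phase n) :=
  (sympForm n).orthogonal L

variable {k : ℕ} {L G : Submodule ℝ (Phase n)}

theorem mem_sympOrth {Z : Phase n} : Z ∈ sympOrth L ↔ ∀ X ∈ L, symp X Z = 0 := Iff.rfl

theorem finrank_add_finrank_sympOrth (L : Submodule ℝ (Phase n)) :
    Module.finrank ℝ L + Module.finrank ℝ (sympOrth L) = Module.finrank ℝ (Phase n) := by
  rw [sympOrth, LinearMap.BilinForm.finrank_orthogonal sympForm_nondegenerate]
  exact Nat.add_sub_cancel' L.finrank_le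

theorem IsIsotropicPlane.le_sympOrth (hL : IsIsotropicPlane k L) : L ≤ sympOrth L :=
  fun _ hY X hX => hL.2 X hX _ hY

theorem IsGaugeSurface.isCompl_sympOrth (hG : IsGaugeSurface k L G) (hL : IsIsotropicPlane k L) :
    IsCompl G (sympOrth L) := by
  refine (Submodule.isCompl_iff_disjoint _ _ ?_).2 (Submodule.disjoint_def.2 fun Y hY hY' => ?_)
  · rw [hG.1.1, ← hL.1, finrank_add_finrank_sympOrth]
  · refine hG.2 Y (Submodule.mem_sup_right hY) fun W hW => ?_
    obtain ⟨X, hX, Y', hY'', rfl⟩ := Submodule.mem_sup.1 hW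
    rw [← sympForm_apply, map_add, sympForm_apply, sympForm_apply, symp_swap,
      mem_sympOrth.1 hY' X hX, hG.1.2 Y hY Y' hY'', neg_zero, add_zero]

/-- The pairing of two planes by the symplectic form. -/
def sympPairing (L G : Submodule ℝ (Phase n)) : L →L[ℝ] G →L[ℝ] ℝ :=
  (sympForm n).toContinuousBilinearMap.bilinearComp L.subtypeL G.subtypeL

theorem sympPairing_apply (X : L) (Y : G) : sympPairing L G X Y = symp (X : Phase n) Y := rfl

theorem sympPairing_injective (hG : IsCompl G (sympOrth L)) :
    Function.Injective (sympPairing L G) := by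
  refine (injective_iff_map_eq_zero _).2 fun X hX => Subtype.ext ?_
  refine sympForm_nondegenerate.1 (X : Phase n) fun Z => ?_
  obtain ⟨Y, hY, Y', hY', rfl⟩ := Submodule.mem_sup.1
    (hG.sup_eq_top ▸ Submodule.mem_top : Z ∈ G ⊔ sympOrth L)
  have hXY : symp X Y = 0 := DFunLike.congr_fun hX ⟨Y, hY⟩
  rw [map_add, sympForm_apply, sympForm_apply, hXY, mem_sympOrth.1 hY' X X.2, add_zero]

theorem exists_sympPairing_inversion (hG : IsCompl G (sympOrth L))
    (μ : Measure L) [μ.IsAddHaarMeasure] (σ : Measure G) [σ.IsAddHaarMeasure] :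
    ∃ Δ : ℝ, 0 < Δ ∧ ∀ ρ : 𝓢(G, ℂ),
      (∀ X : L, Integrable (fun Y : G =>
        ρ Y * Complex.exp (Complex.I * (symp (X : Phase n) (Y : Phase n) : ℂ))) σ) ∧
      Integrable (fun X : L => ∫ Y : G,
        ρ Y * Complex.exp (Complex.I * (symp (X : Phase n) (Y : Phase n) : ℂ)) ∂σ) μ ∧
      ∫ X : L, (∫ Y : G,
        ρ Y * Complex.exp (Complex.I * (symp (X : Phase n) (Y : Phase n) : ℂ)) ∂σ) ∂μ
          = ρ 0 * (Δ : ℂ) := by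
  have hdim : Module.finrank ℝ L = Module.finrank ℝ G := Nat.add_right_cancel <|
    (finrank_add_finrank_sympOrth L).trans (Submodule.finrank_add_eq_of_isCompl hG).symm
  simpa only [sympPairing_apply] using
    exists_fourier_inversion_zero μ σ (sympPairing_injective hG) hdim

end Symplectic

section ParameterIntegral

variable {M V : Type*} [NormedAddCommGroup M] [NormedSpace ℝ M] [FiniteDimensional ℝ M]
  [MeasurableSpace M] [BorelSpace M] [NormedAddCommGroup V] [NormedSpace ℝ V]
  (μ : Measure M) [μ.IsAddHaarMeasure] {f : M × V → ℂ}

theorem IsSchwartz.hasLineDerivAt_integral (hf : IsSchwartz f) {f' : M → V → ℂ} {w : V}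
    (hf' : ∀ y v, HasLineDerivAt ℝ (fun v => f (y, v)) (f' y v) v w) (v : V) :
    HasLineDerivAt ℝ (fun v => ∫ y, f (y, v) ∂μ) (∫ y, f' y v ∂μ) v w := by
  obtain ⟨f, rfl⟩ := hf
  have hderiv : ∀ y, (∂_{((0 : M), w)} f) (y, v) = f' y v := fun y => by
    have h : HasLineDerivAt ℝ (fun v => f (y, v)) ((∂_{((0 : M), w)} f) (y, v)) v w := by
      simpa [HasLineDerivAt, SchwartzMap.lineDerivOp_apply_eq_fderiv] using
        (f.hasFDerivAt (y, v)).hasLineDerivAt ((0 : M), w)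
    exact h.unique (hf' y v)
  have h := hasLineDerivAt_partialFourier μ (0 : M →L[ℝ] ℝ →L[ℝ] ℝ) f (0, v) (0, w)
  simpa [HasLineDerivAt, partialFourier, partialFourierDeriv, linearMul_apply, hderiv] using h

variable [FiniteDimensional ℝ V]

-- Without frequencies, the partial Fourier integral is the plain integral.
theorem IsSchwartz.integral (hf : IsSchwartz f) : IsSchwartz fun v => ∫ y, f (y, v) ∂μ := by
  obtain ⟨f, rfl⟩ := hf
  have h := isSchwartz_partialFourier μ f (B := (0 : M →L[ℝ] (Fin 0 → ℝ) →L[ℝ] ℝ))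
    fun ℓ => ⟨0, Subsingleton.elim _ _⟩
  simpa [partialFourier] using h.comp_injective (LinearMap.inr_injective (M := Fin 0 → ℝ))

theorem IsSchwartz.integrable_prod [MeasurableSpace V] [BorelSpace V] (ν : Measure V)
    [ν.IsAddHaarMeasure] (hf : IsSchwartz f) : Integrable f (μ.prod ν) := by
  have := FiniteDimensional.proper_real M
  have := FiniteDimensional.proper_real V
  obtain ⟨f, rfl⟩ := hf
  exact f.integrable

end ParameterIntegral

section SchwartzFamily

variable {V M : Type*} [NormedAddCommGroup V] [NormedSpace ℝ V] [NormedAddCommGroup M]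
  [NormedSpace ℝ M]

/-- A family of Schwartz functions that is a Schwartz function of the parameter and the argument
jointly. -/
def IsSchwartzFamily (K : V → 𝓢(M, ℂ)) : Prop :=
  IsSchwartz fun z : V × M => K z.1 z.2

theorem exists_isSchwartzFamily {k : V × M → ℂ} (hk : IsSchwartz k) :
    ∃ K : V → 𝓢(M, ℂ), IsSchwartzFamily K ∧ ∀ v y, K v y = k (v, y) := by
  obtain ⟨k, rfl⟩ := hk
  have hg (v : V) : (fun y : M => (v, y)).HasTemperateGrowth := by
    convert (Function.HasTemperateGrowth.const (v, (0 : M))).add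
      (ContinuousLinearMap.inr ℝ V M).hasTemperateGrowth using 1
    ext y <;> simp
  have hanti (v : V) : AntilipschitzWith 1 fun y : M => (v, y) := fun x y => by
    simp [Prod.edist_eq]
  exact ⟨fun v => SchwartzMap.compCLMOfAntilipschitz ℝ (hg v) (hanti v) k, ⟨k, rfl⟩,
    fun _ _ => rfl⟩

namespace IsSchwartzFamily

-- A single Schwartz function is encoded as a family over the zero space `Fin 0 → ℝ`.
theorem const [FiniteDimensional ℝ V] [FiniteDimensional ℝ M] [Subsingleton V] (ψ : 𝓢(M, ℂ)) :
    IsSchwartzFamily fun _ : V => ψ :=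
  IsSchwartz.comp_injective ⟨ψ, rfl⟩ (A := LinearMap.snd ℝ V M)
    fun _ _ h => Prod.ext (Subsingleton.elim _ _) h

variable {K : V → 𝓢(M, ℂ)}

theorem linear_smul (hK : IsSchwartzFamily K) (ℓ : V →L[ℝ] ℝ) :
    IsSchwartzFamily fun v => ℓ v • K v := by
  have hℓ : (fun z : V × M => (ℓ z.1 : ℂ)).HasTemperateGrowth :=
    (Complex.ofRealCLM ∘L ℓ ∘L ContinuousLinearMap.fst ℝ V M).hasTemperateGrowth
  simpa [IsSchwartzFamily] using hK.temperate_mul hℓ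

theorem exists_hasLineDerivAt (hK : IsSchwartzFamily K) (w : V) :
    ∃ K' : V → 𝓢(M, ℂ), IsSchwartzFamily K' ∧
      ∀ v y, HasLineDerivAt ℝ (fun v => K v y) (K' v y) v w := by
  obtain ⟨k, hk⟩ := hK
  obtain ⟨K', hK', hK'_eq⟩ := exists_isSchwartzFamily ⟨∂_{(w, (0 : M))} k, rfl⟩
  refine ⟨K', hK', fun v y => ?_⟩
  have hv : (fun v => K v y) = fun v => k (v, y) := funext fun v => (congrFun hk (v, y)).symm
  rw [hK'_eq, hv]
  simpa [HasLineDerivAt, SchwartzMap.lineDerivOp_apply_eq_fderiv] using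
    (k.hasFDerivAt (v, y)).hasLineDerivAt (w, (0 : M))

theorem integrable_apply [FiniteDimensional ℝ V] [MeasurableSpace V] [BorelSpace V]
    (hK : IsSchwartzFamily K) (ν : Measure V) [ν.IsAddHaarMeasure] (y : M) :
    Integrable (fun v => K v y) ν := by
  obtain ⟨k, hk⟩ := hK
  obtain ⟨b, hb, hkb⟩ := exists_integrable_majorant ν k
  have hKy : (fun v => K v y) = fun v => k (v, y) := funext fun v => (congrFun hk (v, y)).symm
  rw [hKy]
  exact hb.mono' (k.continuous.comp (by fun_prop)).aestronglyMeasurable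
    (.of_forall fun v => hkb v y)

end IsSchwartzFamily

end SchwartzFamily

/-! ### Weyl operators on Schwartz functions -/

section InnerS

variable {n : ℕ}

theorem weylPhase_eq_mul (X : Phase n) (ξ : Conf n) :
    weylPhase X ξ = weylPhase X 0 * Complex.exp (Complex.I * (inner ℝ X.1 ξ : ℝ)) := by
  simp only [weylPhase, ← Complex.exp_add, dotp_eq_inner, inner_zero_right]
  congr 1
  push_cast
  ring

theorem conj_weylPhase_mul_weylPhase (X : Phase n) (ξ : Conf n) :
    (starRingEnd ℂ) (weylPhase X ξ) * weylPhase X ξ = 1 := by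
  rw [Complex.conj_mul', weylPhase, norm_cexp_I_mul_ofReal]
  simp

theorem integrable_conj_mul (φ ψ : 𝓢(Conf n, ℂ)) :
    Integrable fun ξ => (starRingEnd ℂ) (φ ξ) * ψ ξ := by
  obtain ⟨h, hh⟩ := IsSchwartz.temperate_mul (conjS φ).hasTemperateGrowth ⟨ψ, rfl⟩
  simpa only [hh, conjS_apply] using h.integrable (μ := volume)

theorem innerS_add_left (φ φ' ψ : 𝓢(Conf n, ℂ)) :
    innerS (φ + φ') ψ = innerS φ ψ + innerS φ' ψ := by
  simp only [innerS, add_apply, map_add, add_mul]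
  exact integral_add (integrable_conj_mul φ ψ) (integrable_conj_mul φ' ψ)

theorem innerS_smul_left (c : ℂ) (φ ψ : 𝓢(Conf n, ℂ)) :
    innerS (c • φ) ψ = (starRingEnd ℂ) c * innerS φ ψ := by
  simp only [innerS, smul_apply, smul_eq_mul, map_mul, mul_assoc]
  exact integral_const_mul _ _

theorem innerS_conj_symm (φ ψ : 𝓢(Conf n, ℂ)) : (starRingEnd ℂ) (innerS ψ φ) = innerS φ ψ := by
  simp only [innerS, ← integral_conj, map_mul, Complex.conj_conj, mul_comm]

theorem innerS_weyl_weyl (X : Phase n) (φ ψ : 𝓢(Conf n, ℂ)) :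
    innerS (weyl X φ) (weyl X ψ) = innerS φ ψ := by
  rw [innerS, innerS, ← integral_sub_right_eq_self (fun ξ => (starRingEnd ℂ) (φ ξ) * ψ ξ) X.2]
  congr 1 with ξ
  rw [weyl_apply, weyl_apply, map_mul]
  linear_combination (starRingEnd ℂ) (φ (ξ - X.2)) * ψ (ξ - X.2) *
    conj_weylPhase_mul_weylPhase X ξ

theorem weyl_swap (X Y : Phase n) (ψ : 𝓢(Conf n, ℂ)) :
    weyl X (weyl Y ψ) = Complex.exp (Complex.I * (symp X Y : ℂ)) • weyl Y (weyl X ψ) := by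
  rw [weyl_weyl, weyl_weyl Y X, smul_smul, ← Complex.exp_add, add_comm Y X, symp_swap Y X]
  congr 2
  push_cast
  ring

theorem weyl_comm {X Y : Phase n} (h : symp X Y = 0) (ψ : 𝓢(Conf n, ℂ)) :
    weyl X (weyl Y ψ) = weyl Y (weyl X ψ) := by
  simp [weyl_swap X Y, h]

theorem weyl_add {X Y : Phase n} (h : symp X Y = 0) (ψ : 𝓢(Conf n, ℂ)) :
    weyl X (weyl Y ψ) = weyl (X + Y) ψ := by
  simp [weyl_weyl, h]

theorem weyl_neg_weyl (X : Phase n) (ψ : 𝓢(Conf n, ℂ)) : weyl (-X) (weyl X ψ) = ψ := by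
  rw [weyl_add (by simp [symp]), neg_add_cancel, weyl_zero]

theorem innerS_weyl_right (X : Phase n) (φ ψ : 𝓢(Conf n, ℂ)) :
    innerS φ (weyl X ψ) = innerS (weyl (-X) φ) ψ := by
  rw [← innerS_weyl_weyl (-X), weyl_neg_weyl]

theorem conjS_conjS (ψ : 𝓢(Conf n, ℂ)) : conjS (conjS ψ) = ψ := by
  ext ξ
  simp [conjS_apply]

theorem conjS_weyl (X : Phase n) (ψ : 𝓢(Conf n, ℂ)) :
    conjS (weyl (X.1, -X.2) ψ) = weyl (-X) (conjS ψ) := by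
  ext ξ
  rw [conjS_apply, weyl_apply, weyl_apply, conjS_apply, map_mul]
  congr 1
  rw [weylPhase, weylPhase, ← Complex.exp_conj, map_mul, Complex.conj_I, Complex.conj_ofReal]
  simp only [dotp_eq_inner, inner_neg_right, Prod.fst_neg, Prod.snd_neg, inner_neg_left]
  push_cast
  ring_nf

theorem integral_mul_eq_innerS (φ ψ : 𝓢(Conf n, ℂ)) : ∫ ξ, φ ξ * ψ ξ = innerS (conjS ψ) φ := by
  simp only [innerS, conjS_apply, Complex.conj_conj, mul_comm]

end InnerS

section WeylFamilies

variable {n : ℕ} {V V₁ V₂ : Type*} [NormedAddCommGroup V] [NormedSpace ℝ V]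
  [NormedAddCommGroup V₁] [NormedSpace ℝ V₁] [NormedAddCommGroup V₂] [NormedSpace ℝ V₂]

theorem weylPhase_comp_hasTemperateGrowth (A : V →L[ℝ] Phase n) (g : V →L[ℝ] Conf n) :
    (fun x => weylPhase (A x) (g x)).HasTemperateGrowth := by
  have h₁ : (fun x => innerSL ℝ (A x).1 (g x)).HasTemperateGrowth :=
    (innerSL ℝ).bilinear_hasTemperateGrowth
      (ContinuousLinearMap.fst ℝ _ _ ∘L A).hasTemperateGrowth g.hasTemperateGrowth
  have h₂ : (fun x => innerSL ℝ (A x).1 (A x).2).HasTemperateGrowth :=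
    (innerSL ℝ).bilinear_hasTemperateGrowth
      (ContinuousLinearMap.fst ℝ _ _ ∘L A).hasTemperateGrowth
      (ContinuousLinearMap.snd ℝ _ _ ∘L A).hasTemperateGrowth
  have h : (fun x => dotp (A x).1 (g x) - dotp (A x).1 (A x).2 / 2).HasTemperateGrowth := by
    simpa [dotp_eq_inner, div_eq_mul_inv, Pi.sub_def, Pi.mul_def] using
      h₁.sub (h₂.mul (Function.HasTemperateGrowth.const (2⁻¹ : ℝ)))
  exact expI_hasTemperateGrowth.comp h

namespace IsSchwartzFamily

theorem conj {K : V → 𝓢(Conf n, ℂ)} (hK : IsSchwartzFamily K) :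
    IsSchwartzFamily fun v => conjS (K v) :=
  IsSchwartz.conj hK

variable [FiniteDimensional ℝ V] [FiniteDimensional ℝ V₁] [FiniteDimensional ℝ V₂]

theorem smul_weyl (F : 𝓢(V, ℂ)) (A : V →L[ℝ] Phase n) (ψ : 𝓢(Conf n, ℂ)) :
    IsSchwartzFamily fun v => F v • weyl (A v) ψ := by
  let T : V × Conf n →ₗ[ℝ] V × Conf n :=
    (LinearMap.fst ℝ V (Conf n)).prod (LinearMap.snd ℝ V (Conf n) -
      LinearMap.snd ℝ (Conf n) (Conf n) ∘ₗ A.toLinearMap ∘ₗ LinearMap.fst ℝ V (Conf n))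
  have hT : Function.Injective T := by
    rintro ⟨v, η⟩ ⟨v', η'⟩ h
    obtain ⟨rfl, h⟩ : v = v' ∧ η - (A v).2 = η' - (A v').2 := by simpa [T] using h
    simpa using h
  have hphase := weylPhase_comp_hasTemperateGrowth (A ∘L ContinuousLinearMap.fst ℝ V (Conf n))
    (ContinuousLinearMap.snd ℝ V (Conf n))
  have h := ((IsSchwartz.tensor ⟨F, rfl⟩ ⟨ψ, rfl⟩).comp_injective hT).temperate_mul hphase
  simpa [IsSchwartzFamily, weyl_apply, T, mul_left_comm] using h

variable {K₁ : V₁ → 𝓢(Conf n, ℂ)} {K₂ : V₂ → 𝓢(Conf n, ℂ)}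

theorem isSchwartz_innerS_weyl (h₁ : IsSchwartzFamily K₁) (h₂ : IsSchwartzFamily K₂) :
    IsSchwartz fun z : Phase n × (V₁ × V₂) => innerS (K₁ z.2.1) (weyl z.1 (K₂ z.2.2)) := by
  let T : Conf n × (Conf n × (V₁ × V₂)) →ₗ[ℝ] (V₁ × Conf n) × (V₂ × Conf n) :=
    { toFun := fun z => ((z.2.2.1, z.1), (z.2.2.2, z.1 - z.2.1))
      map_add' := fun x y => by simp [add_sub_add_comm]
      map_smul' := fun c x => by simp [smul_sub] }
  have hT : Function.Injective T := by
    rintro ⟨η, Q, v₁, v₂⟩ ⟨η', Q', v₁', v₂'⟩ h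
    obtain ⟨⟨rfl, rfl⟩, rfl, hQ⟩ : (v₁ = v₁' ∧ η = η') ∧ v₂ = v₂' ∧ η - Q = η' - Q' := by
      simpa [T] using h
    simpa using hQ
  obtain ⟨f, hf⟩ := (IsSchwartz.tensor h₁.conj h₂).comp_injective hT
  have hB : Function.Surjective (innerSL ℝ : Conf n →L[ℝ] Conf n →L[ℝ] ℝ) :=
    (InnerProductSpace.toDual ℝ (Conf n)).surjective
  have hassoc := (LinearEquiv.prodAssoc ℝ (Conf n) (Conf n) (V₁ × V₂)).injective
  have hphase := weylPhase_comp_hasTemperateGrowth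
    (ContinuousLinearMap.fst ℝ (Phase n) (V₁ × V₂)) 0
  have h := ((isSchwartz_partialFourier volume f hB).comp_injective
    (A := (LinearEquiv.prodAssoc ℝ (Conf n) (Conf n) (V₁ × V₂)).toLinearMap) hassoc).temperate_mul
    hphase
  convert h using 2 with ⟨X, v₁, v₂⟩
  simp only [innerS, partialFourier, hf, ← integral_const_mul]
  congr 1 with ξ
  rw [weyl_apply, weylPhase_eq_mul, innerSL_apply_apply, real_inner_comm]
  change (starRingEnd ℂ) (K₁ v₁ ξ) * (_ * K₂ v₂ (ξ - X.2)) =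
    weylPhase X 0 * (Complex.exp (Complex.I * (inner ℝ ξ X.1 : ℝ)) * ((starRingEnd ℂ) (K₁ v₁ ξ) *
      K₂ v₂ (ξ - X.2)))
  ring

theorem isSchwartz_innerS_weyl_subtype (L : Submodule ℝ (Phase n)) (h₁ : IsSchwartzFamily K₁)
    (h₂ : IsSchwartzFamily K₂) :
    IsSchwartz fun z : L × (V₁ × V₂) => innerS (K₁ z.2.1) (weyl (z.1 : Phase n) (K₂ z.2.2)) :=
  (h₁.isSchwartz_innerS_weyl h₂).comp_injective (A := L.subtype.prodMap LinearMap.id)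
    (L.subtype_injective.prodMap Function.injective_id)

theorem isSchwartz_innerS_weyl_right (L : Submodule ℝ (Phase n)) (φ : 𝓢(Conf n, ℂ))
    (h₂ : IsSchwartzFamily K₂) :
    IsSchwartz fun z : L × V₂ => innerS φ (weyl (z.1 : Phase n) (K₂ z.2)) :=
  ((IsSchwartzFamily.const (V := Fin 0 → ℝ) φ).isSchwartz_innerS_weyl_subtype L h₂).comp_injective
    (A := LinearMap.id.prodMap (LinearMap.inr ℝ (Fin 0 → ℝ) V₂))
    (Function.injective_id.prodMap LinearMap.inr_injective)

end IsSchwartzFamily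

theorem isSchwartz_innerS_weyl (L : Submodule ℝ (Phase n)) (φ ψ : 𝓢(Conf n, ℂ)) :
    IsSchwartz fun X : L => innerS φ (weyl (X : Phase n) ψ) :=
  ((IsSchwartzFamily.const (V := Fin 0 → ℝ) ψ).isSchwartz_innerS_weyl_right L φ).comp_injective
    (A := LinearMap.inl ℝ L (Fin 0 → ℝ)) LinearMap.inl_injective

end WeylFamilies

/-! ### Positivity of the algebraic inner product -/

section PositiveType

variable {E : Type*} [NormedAddCommGroup E] [NormedSpace ℝ E] [FiniteDimensional ℝ E]

theorem exists_schwartz_eventuallyEq_one (x₀ : E) : ∃ f : 𝓢(E, ℂ), ∀ᶠ x in 𝓝 x₀, f x = 1 := by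
  let b : ContDiffBump x₀ := default
  have hb : HasCompactSupport fun x => (b x : ℂ) :=
    b.hasCompactSupport.comp_left (g := fun t : ℝ => (t : ℂ)) Complex.ofReal_zero
  refine ⟨hb.toSchwartzMap (Complex.ofRealCLM.contDiff.comp b.contDiff), ?_⟩
  filter_upwards [b.eventuallyEq_one] with x hx
  change (b x : ℂ) = 1
  simp [hx]

variable [MeasurableSpace E]

/-- The autocorrelation `v ↦ ∫ χ(x - v)* χ(x) dμ(x)`, the basic function of positive type. -/
def autocorrelation (μ : Measure E) (χ : 𝓢(E, ℂ)) (v : E) : ℂ :=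
  ∫ x, (starRingEnd ℂ) (χ (x - v)) * χ x ∂μ

variable [BorelSpace E] (μ : Measure E) [μ.IsAddHaarMeasure]

theorem isSchwartz_autocorrelation (χ : 𝓢(E, ℂ)) : IsSchwartz (autocorrelation μ χ) := by
  let T : E × E →ₗ[ℝ] E × E :=
    (LinearMap.fst ℝ E E - LinearMap.snd ℝ E E).prod (LinearMap.fst ℝ E E)
  have hT : Function.Injective T := by
    rintro ⟨x, v⟩ ⟨x', v'⟩ h
    obtain ⟨h, rfl⟩ : x - v = x' - v' ∧ x = x' := by simpa [T] using h
    simpa using h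
  have hχ : IsSchwartz χ := ⟨χ, rfl⟩
  exact ((hχ.conj.tensor hχ).comp_injective hT).integral μ

theorem exists_autocorrelation_zero_pos :
    ∃ χ : 𝓢(E, ℂ), ∃ r : ℝ, 0 < r ∧ autocorrelation μ χ 0 = r := by
  obtain ⟨χ, hχ⟩ := exists_schwartz_eventuallyEq_one (0 : E)
  have hcont : Continuous fun x => ‖χ x‖ ^ 2 := by
    have := χ.continuous
    fun_prop
  have hint : Integrable (fun x => ‖χ x‖ ^ 2) μ := by
    have := FiniteDimensional.proper_real E
    exact (χ.memLp 2 μ).integrable_norm_pow two_ne_zero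
  refine ⟨χ, ∫ x, ‖χ x‖ ^ 2 ∂μ, ?_, ?_⟩
  · refine integral_pos_of_integrable_nonneg_nonzero hcont hint (fun x => by positivity) (x := 0) ?_
    simp [hχ.self_of_nhds]
  · simp only [autocorrelation, sub_zero, Complex.conj_mul', ← Complex.ofReal_pow]
    exact integral_ofReal

theorem exists_autocorrelation_comp_smul (χ : 𝓢(E, ℂ)) {t : ℝ} (ht : t ≠ 0) :
    ∃ χ' : 𝓢(E, ℂ), ∃ r : ℝ, 0 < r ∧
      ∀ v, autocorrelation μ χ' v = r * autocorrelation μ χ (t • v) := by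
  obtain ⟨χ', hχ'⟩ := IsSchwartz.comp_injective ⟨χ, rfl⟩ (A := t • LinearMap.id)
    (fun x y h => smul_right_injective E ht (by simpa using h))
  refine ⟨χ', |(t ^ Module.finrank ℝ E)⁻¹|, by positivity, fun v => ?_⟩
  have h := Measure.integral_comp_smul μ (fun x => (starRingEnd ℂ) (χ (x - t • v)) * χ x) t
  rw [Complex.real_smul] at h
  rw [autocorrelation, autocorrelation, ← h]
  simp [hχ', smul_sub]

theorem tendsto_integral_mul_comp_smul (a c : 𝓢(E, ℂ)) :
    Tendsto (fun m : ℕ => ∫ v, a v * c ((1 / ((m : ℝ) + 1)) • v) ∂μ) atTop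
      (𝓝 ((∫ v, a v ∂μ) * c 0)) := by
  rw [← integral_mul_const]
  have ha := a.continuous
  have hc := c.continuous
  have haint : Integrable a μ := by
    have := FiniteDimensional.proper_real E
    exact a.integrable
  refine tendsto_integral_of_dominated_convergence
    (fun v => ‖a v‖ * (SchwartzMap.seminorm ℝ 0 0) c)
    (fun m => Continuous.aestronglyMeasurable (by fun_prop)) (haint.norm.mul_const _)
    (fun m => .of_forall fun v => ?_) (.of_forall fun v => ?_)
  · rw [norm_mul]
    gcongr
    exact SchwartzMap.norm_le_seminorm ℝ c _
  · have h := (tendsto_one_div_add_atTop_nhds_zero_nat (𝕜 := ℝ)).smul_const v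
    rw [zero_smul] at h
    exact ((hc.tendsto 0).comp h).const_mul _

theorem integral_mul_autocorrelation (a χ : 𝓢(E, ℂ)) :
    ∫ v, a v * autocorrelation μ χ v ∂μ =
      ∫ y, ∫ x, (starRingEnd ℂ) (χ x) * χ y * a (y - x) ∂μ ∂μ := by
  have := FiniteDimensional.proper_real E
  obtain ⟨χ', hχ'⟩ := IsSchwartz.conj ⟨χ, rfl⟩
  have hχ'_sub : (fun z : E × E => χ' (z.1 - z.2)).HasTemperateGrowth :=
    χ'.hasTemperateGrowth.comp
      (ContinuousLinearMap.fst ℝ E E - ContinuousLinearMap.snd ℝ E E).hasTemperateGrowth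
  have hint := ((IsSchwartz.tensor ⟨χ, rfl⟩ ⟨a, rfl⟩).temperate_mul hχ'_sub).integrable_prod μ μ
  simp only [hχ'] at hint
  calc ∫ v, a v * autocorrelation μ χ v ∂μ
      = ∫ v, ∫ y, (starRingEnd ℂ) (χ (y - v)) * (χ y * a v) ∂μ ∂μ := by
        simp only [autocorrelation, ← integral_const_mul]
        congr! 4
        ring
    _ = ∫ y, ∫ v, (starRingEnd ℂ) (χ (y - v)) * (χ y * a v) ∂μ ∂μ :=
        (integral_integral_swap hint).symm
    _ = _ := by
        congr 1 with y
        rw [← integral_sub_left_eq_self _ μ y]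
        simp only [sub_sub_cancel, mul_assoc]

-- The integral of `a` is the limit of its pairings with ever wider autocorrelations.
theorem re_integral_nonneg_of_autocorrelation (a : 𝓢(E, ℂ))
    (ha : ∀ χ : 𝓢(E, ℂ), 0 ≤ (∫ v, a v * autocorrelation μ χ v ∂μ).re) :
    0 ≤ (∫ v, a v ∂μ).re := by
  obtain ⟨χ, r, hr, hχ⟩ := exists_autocorrelation_zero_pos μ
  obtain ⟨c, hc⟩ := isSchwartz_autocorrelation μ χ
  have hscaled : ∀ m : ℕ, 0 ≤ (∫ v, a v * c ((1 / ((m : ℝ) + 1)) • v) ∂μ).re := fun m => by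
    obtain ⟨χ', s, hs, hχ'⟩ := exists_autocorrelation_comp_smul μ χ
      (t := 1 / ((m : ℝ) + 1)) (by positivity)
    have h := ha χ'
    simp only [hχ', ← hc, mul_left_comm (a _), integral_const_mul, Complex.re_ofReal_mul] at h
    exact nonneg_of_mul_nonneg_right h hs
  have hlim := ge_of_tendsto ((Complex.continuous_re.tendsto _).comp
    (tendsto_integral_mul_comp_smul μ a c)) (.of_forall hscaled)
  rw [hc, hχ, Complex.re_mul_ofReal] at hlim
  exact nonneg_of_mul_nonneg_left hlim hr

end PositiveType

section FamilyIntegral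

variable {n : ℕ} {V : Type*} [NormedAddCommGroup V] [NormedSpace ℝ V] [FiniteDimensional ℝ V]
  [MeasurableSpace V] [BorelSpace V] (ν : Measure V) [ν.IsAddHaarMeasure]
  {K : V → 𝓢(Conf n, ℂ)}

theorem IsSchwartzFamily.exists_integral_eq (hK : IsSchwartzFamily K) :
    ∃ J : 𝓢(Conf n, ℂ), ∀ η, J η = ∫ v, K v η ∂ν :=
  let ⟨J, hJ⟩ := IsSchwartz.integral ν hK
  ⟨J, congrFun hJ⟩

theorem IsSchwartzFamily.integral_innerS (hK : IsSchwartzFamily K) (φ : 𝓢(Conf n, ℂ))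
    {J : 𝓢(Conf n, ℂ)} (hJ : ∀ η, J η = ∫ v, K v η ∂ν) :
    ∫ v, innerS φ (K v) ∂ν = innerS φ J := by
  have hφ : (fun z : V × Conf n => conjS φ z.2).HasTemperateGrowth :=
    (conjS φ).hasTemperateGrowth.comp (ContinuousLinearMap.snd ℝ V (Conf n)).hasTemperateGrowth
  have hint := (hK.temperate_mul hφ).integrable_prod ν volume
  simp only [innerS, hJ, ← integral_const_mul]
  exact integral_integral_swap hint

end FamilyIntegral

section AlgInner

variable {n : ℕ} {L : Submodule ℝ (Phase n)} (μ : Measure L)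

theorem algInner_smul_left (c : ℂ) (φ ψ : 𝓢(Conf n, ℂ)) :
    algInner μ (c • φ) ψ = (starRingEnd ℂ) c * algInner μ φ ψ := by
  simp only [algInner, innerS_smul_left]
  exact integral_const_mul _ _

theorem etaMap_eq_algInner (ψ χ : 𝓢(Conf n, ℂ)) : etaMap μ ψ χ = algInner μ (conjS χ) ψ := by
  simp only [etaMap, algInner, integral_mul_eq_innerS]

theorem algInner_weyl_weyl {Z : Phase n} (hZ : Z ∈ sympOrth L) (φ ψ : 𝓢(Conf n, ℂ)) :
    algInner μ (weyl Z φ) (weyl Z ψ) = algInner μ φ ψ := by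
  rw [algInner, algInner]
  congr 1 with X
  rw [weyl_comm (mem_sympOrth.1 hZ X X.2), innerS_weyl_weyl]

variable [μ.IsAddHaarMeasure]

theorem integrable_innerS_weyl (φ ψ : 𝓢(Conf n, ℂ)) :
    Integrable (fun X : L => innerS φ (weyl (X : Phase n) ψ)) μ := by
  obtain ⟨a, ha⟩ := isSchwartz_innerS_weyl L φ ψ
  rw [← ha]
  exact a.integrable

theorem algInner_add_left (φ φ' ψ : 𝓢(Conf n, ℂ)) :
    algInner μ (φ + φ') ψ = algInner μ φ ψ + algInner μ φ' ψ := by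
  simp only [algInner, innerS_add_left]
  exact integral_add (integrable_innerS_weyl μ φ ψ) (integrable_innerS_weyl μ φ' ψ)

theorem algInner_conj_symm (φ ψ : 𝓢(Conf n, ℂ)) :
    (starRingEnd ℂ) (algInner μ ψ φ) = algInner μ φ ψ := by
  have := FiniteDimensional.proper_real L
  rw [algInner, algInner, ← integral_conj, ← integral_neg_eq_self]
  congr 1 with X
  rw [innerS_conj_symm, innerS_weyl_right (X : Phase n), Submodule.coe_neg]

theorem algInner_weyl_right (hL : L ≤ sympOrth L) (X : L) (φ ψ : 𝓢(Conf n, ℂ)) :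
    algInner μ φ (weyl (X : Phase n) ψ) = algInner μ φ ψ := by
  rw [algInner, algInner,
    ← integral_add_right_eq_self (fun Y : L => innerS φ (weyl (Y : Phase n) ψ)) X]
  congr 1 with Y
  rw [weyl_add (mem_sympOrth.1 (hL X.2) Y Y.2), Submodule.coe_add]

theorem re_innerS_self_nonneg (ψ : 𝓢(Conf n, ℂ)) : 0 ≤ (innerS ψ ψ).re := by
  have h : innerS ψ ψ = ((∫ x, ‖ψ x‖ ^ 2 : ℝ) : ℂ) := by
    simp only [innerS, Complex.conj_mul', ← Complex.ofReal_pow]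
    exact integral_ofReal
  rw [h, Complex.ofReal_re]
  positivity

theorem innerS_smul_weyl_smul_weyl (hL : L ≤ sympOrth L) (ψ : 𝓢(Conf n, ℂ)) (c d : ℂ) (X Y : L) :
    innerS (c • weyl (X : Phase n) ψ) (d • weyl (Y : Phase n) ψ) =
      (starRingEnd ℂ) c * d * innerS ψ (weyl ((Y - X : L) : Phase n) ψ) := by
  have hXY : symp (-(X : Phase n)) Y = 0 := mem_sympOrth.1 (hL Y.2) _ (neg_mem X.2)
  have hinner : innerS (weyl (X : Phase n) ψ) (weyl (Y : Phase n) ψ) =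
      innerS ψ (weyl ((Y - X : L) : Phase n) ψ) := by
    rw [← innerS_weyl_weyl (-(X : Phase n)), weyl_neg_weyl, weyl_add hXY, Submodule.coe_sub,
      neg_add_eq_sub]
  rw [innerS_smul_left, ← innerS_conj_symm, innerS_smul_left, map_mul, innerS_conj_symm,
    Complex.conj_conj, hinner, mul_assoc]

theorem integral_mul_autocorrelation_eq_innerS (hL : L ≤ sympOrth L) {ψ : 𝓢(Conf n, ℂ)}
    {χ a : 𝓢(L, ℂ)} (ha : ∀ X : L, a X = innerS ψ (weyl (X : Phase n) ψ)) {w : 𝓢(Conf n, ℂ)}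
    (hw : ∀ η, w η = ∫ X : L, (χ X • weyl (X : Phase n) ψ) η ∂μ) :
    ∫ V, a V * autocorrelation μ χ V ∂μ = innerS w w := by
  have hK : IsSchwartzFamily fun X : L => χ X • weyl (X : Phase n) ψ :=
    IsSchwartzFamily.smul_weyl χ L.subtypeL ψ
  have hw_left (Y : L) : innerS w (χ Y • weyl (Y : Phase n) ψ) =
      ∫ X, (starRingEnd ℂ) (χ X) * χ Y * a (Y - X) ∂μ := by
    rw [← innerS_conj_symm, ← hK.integral_innerS μ _ hw, ← integral_conj]
    congr 1 with X
    rw [innerS_conj_symm, innerS_smul_weyl_smul_weyl hL, ha]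
  rw [integral_mul_autocorrelation, ← hK.integral_innerS μ w hw]
  simp only [hw_left]

theorem re_algInner_self_nonneg (hL : L ≤ sympOrth L) (ψ : 𝓢(Conf n, ℂ)) :
    0 ≤ (algInner μ ψ ψ).re := by
  obtain ⟨a, ha⟩ := isSchwartz_innerS_weyl L ψ ψ
  rw [algInner, ← ha]
  refine re_integral_nonneg_of_autocorrelation μ a fun χ => ?_
  obtain ⟨w, hw⟩ := (IsSchwartzFamily.smul_weyl χ L.subtypeL ψ).exists_integral_eq μ
  rw [integral_mul_autocorrelation_eq_innerS μ hL (congrFun ha) hw]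
  exact re_innerS_self_nonneg w

end AlgInner

/-! ### The completion and its Weyl operators -/

section Completion

variable {n : ℕ} {L : Submodule ℝ (Phase n)}

/-- The Schwartz space with the seminorm of the algebraic inner product. The two arguments are
recorded in the type so that instances can find the isotropy and the measure. -/
def PreDirac (_hL : L ≤ sympOrth L) (_μ : Measure L) : Type := 𝓢(Conf n, ℂ)

variable (hL : L ≤ sympOrth L) (μ : Measure L)

instance : AddCommGroup (PreDirac hL μ) := inferInstanceAs (AddCommGroup 𝓢(Conf n, ℂ))

instance : Module ℂ (PreDirac hL μ) := inferInstanceAs (Module ℂ 𝓢(Conf n, ℂ))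

variable [μ.IsAddHaarMeasure]

instance preDiracCore : PreInnerProductSpace.Core ℂ (PreDirac hL μ) where
  inner φ ψ := algInner (n := n) μ φ ψ
  conj_inner_symm φ ψ := algInner_conj_symm (n := n) μ φ ψ
  re_inner_nonneg ψ := re_algInner_self_nonneg (n := n) μ hL ψ
  add_left φ φ' ψ := algInner_add_left (n := n) μ φ φ' ψ
  smul_left φ ψ c := algInner_smul_left (n := n) μ c φ ψ

instance : SeminormedAddCommGroup (PreDirac hL μ) :=
  InnerProductSpace.Core.toSeminormedAddCommGroup (𝕜 := ℂ)

instance : InnerProductSpace ℂ (PreDirac hL μ) :=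
  InnerProductSpace.ofCore (preDiracCore hL μ)

/-- The Hilbert space `ℋ`, the completion of the Schwartz space modulo null vectors. -/
abbrev DiracHilbert : Type := UniformSpace.Completion (PreDirac hL μ)

/-- The canonical map from the Schwartz space to the Hilbert space `ℋ`. -/
def toH : 𝓢(Conf n, ℂ) →ₗ[ℂ] DiracHilbert hL μ :=
  (UniformSpace.Completion.toComplₗᵢ (𝕜 := ℂ) (E := PreDirac hL μ)).toLinearMap

theorem inner_toH (φ ψ : 𝓢(Conf n, ℂ)) :
    inner ℂ (toH hL μ φ) (toH hL μ ψ) = algInner μ φ ψ :=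
  UniformSpace.Completion.inner_coe (𝕜 := ℂ) (E := PreDirac hL μ) φ ψ

theorem denseRange_toH : DenseRange (toH hL μ) :=
  UniformSpace.Completion.denseRange_coe (α := PreDirac hL μ)

theorem eq_of_inner_toH {Ψ Ψ' : DiracHilbert hL μ}
    (h : ∀ χ, inner ℂ (toH hL μ χ) Ψ = inner ℂ (toH hL μ χ) Ψ') : Ψ = Ψ' := by
  refine Dense.eq_of_inner_right (𝕜 := ℂ) (denseRange_toH hL μ) ?_
  rintro _ ⟨χ, rfl⟩
  exact h χ

theorem norm_toH_sq (φ : 𝓢(Conf n, ℂ)) : ‖toH hL μ φ‖ ^ 2 = ‖algInner μ φ φ‖ := by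
  rw [← inner_toH hL, inner_self_eq_norm_sq_to_K]
  simp

theorem toH_weyl (X : L) (φ : 𝓢(Conf n, ℂ)) :
    toH hL μ (weyl (X : Phase n) φ) = toH hL μ φ :=
  eq_of_inner_toH hL μ fun χ => by rw [inner_toH, inner_toH, algInner_weyl_right μ hL]

end Completion

section DiracSpace

variable {n : ℕ} {L : Submodule ℝ (Phase n)} (hL : L ≤ sympOrth L) (μ : Measure L)
  [μ.IsAddHaarMeasure]

/-- The value at `χ` of the distribution `η Ψ` that the vector `Ψ` of `ℋ` defines. -/
def diracPairing (Ψ : DiracHilbert hL μ) (χ : 𝓢(Conf n, ℂ)) : ℂ :=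
  inner ℂ (toH hL μ (conjS χ)) Ψ

theorem etaMap_eq_diracPairing (ψ χ : 𝓢(Conf n, ℂ)) :
    etaMap μ ψ χ = diracPairing hL μ (toH hL μ ψ) χ := by
  rw [etaMap_eq_algInner, diracPairing, inner_toH]

theorem eq_of_diracPairing {Ψ Ψ' : DiracHilbert hL μ}
    (h : ∀ χ, diracPairing hL μ Ψ χ = diracPairing hL μ Ψ' χ) : Ψ = Ψ' :=
  eq_of_inner_toH hL μ fun χ => by
    simpa only [diracPairing, conjS_conjS] using h (conjS χ)

theorem IsFundamental.cauchySeq_toH {u : ℕ → 𝓢(Conf n, ℂ)} (h : IsFundamental μ u) :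
    CauchySeq fun m => toH hL μ (u m) := by
  refine Metric.cauchySeq_iff.2 fun ε hε => ?_
  obtain ⟨M, hM⟩ := h (ε ^ 2) (by positivity)
  refine ⟨M, fun m hm l hl => lt_of_pow_lt_pow_left₀ 2 hε.le ?_⟩
  rw [dist_eq_norm, ← map_sub, norm_toH_sq]
  exact hM m hm l hl

theorem Represents.exists_tendsto_toH {u : ℕ → 𝓢(Conf n, ℂ)} {ψD : 𝓢'(Conf n, ℂ)}
    (h : Represents μ u ψD) : ∃ Ψ : DiracHilbert hL μ,
      Tendsto (fun m => toH hL μ (u m)) atTop (𝓝 Ψ) ∧ ∀ χ, ψD χ = diracPairing hL μ Ψ χ := by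
  obtain ⟨Ψ, hΨ⟩ := cauchySeq_tendsto_of_complete (h.1.cauchySeq_toH hL μ)
  refine ⟨Ψ, hΨ, fun χ => tendsto_nhds_unique (h.2 χ) ?_⟩
  simp only [etaMap_eq_diracPairing hL]
  exact tendsto_const_nhds.inner hΨ

theorem isDiracInnerSelf_inner_self {ψD : 𝓢'(Conf n, ℂ)} (hψ : ψD ∈ diracSpace μ)
    {Ψ : DiracHilbert hL μ} (hΨ : ∀ χ, ψD χ = diracPairing hL μ Ψ χ) :
    IsDiracInnerSelf μ ψD (inner ℂ Ψ Ψ) := by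
  refine ⟨hψ, fun u hu => ?_⟩
  obtain ⟨Ψ', hlim, hΨ'⟩ := hu.exists_tendsto_toH hL μ
  obtain rfl : Ψ' = Ψ := eq_of_diracPairing hL μ fun χ => by rw [← hΨ, ← hΨ']
  simpa only [inner_toH] using hlim.inner (𝕜 := ℂ) hlim

end DiracSpace

section WeylUnitary

variable {n : ℕ} {L : Submodule ℝ (Phase n)} (hL : L ≤ sympOrth L) (μ : Measure L)
  [μ.IsAddHaarMeasure]

/-- The Weyl operator `exp (i Ω(Z))` as a linear automorphism of the Schwartz space. -/
def weylEquiv (Z : Phase n) : 𝓢(Conf n, ℂ) ≃ₗ[ℂ] 𝓢(Conf n, ℂ) :=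
  .ofLinearMap (weyl Z).toLinearMap (weyl (-Z)).toLinearMap
    (LinearMap.ext fun ψ => by simpa using weyl_neg_weyl (-Z) ψ)
    (LinearMap.ext fun ψ => weyl_neg_weyl Z ψ)

theorem norm_toH_weyl (z : sympOrth L) (φ : 𝓢(Conf n, ℂ)) :
    ‖toH hL μ (weyl (z : Phase n) φ)‖ = ‖toH hL μ φ‖ := by
  rw [← sq_eq_sq₀ (norm_nonneg _) (norm_nonneg _), norm_toH_sq, norm_toH_sq,
    algInner_weyl_weyl μ z.2]

/-- The unitary operator on `ℋ` induced by `exp (i Ω(z))`, for `z` in the symplectic orthogonal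
complement of the plane. -/
def weylH (z : sympOrth L) : DiracHilbert hL μ ≃ₗᵢ[ℂ] DiracHilbert hL μ :=
  (weylEquiv (z : Phase n)).extendOfIsometry (toH hL μ) (toH hL μ) (denseRange_toH hL μ)
    (denseRange_toH hL μ) (norm_toH_weyl hL μ z)

theorem weylH_toH (z : sympOrth L) (φ : 𝓢(Conf n, ℂ)) :
    weylH hL μ z (toH hL μ φ) = toH hL μ (weyl (z : Phase n) φ) :=
  LinearEquiv.extendOfIsometry_eq ..

theorem weylH_zero (Ψ : DiracHilbert hL μ) : weylH hL μ 0 Ψ = Ψ := by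
  refine congrFun ((denseRange_toH hL μ).equalizer (weylH hL μ 0).continuous continuous_id
    (funext fun φ => ?_)) Ψ
  simp [weylH_toH, weyl_zero]

theorem inner_toH_weyl_neg (z : sympOrth L) (φ : 𝓢(Conf n, ℂ)) (Ψ : DiracHilbert hL μ) :
    inner ℂ (toH hL μ (weyl (-(z : Phase n)) φ)) Ψ = inner ℂ (toH hL μ φ) (weylH hL μ z Ψ) := by
  have hφ : weyl (z : Phase n) (weyl (-(z : Phase n)) φ) = φ :=
    (weylEquiv (z : Phase n)).right_inv φ
  rw [← (weylH hL μ z).inner_map_map, weylH_toH, hφ]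

end WeylUnitary

section WeakToStrong

variable {H : Type*} [NormedAddCommGroup H] [InnerProductSpace ℂ H]

theorem continuous_of_continuous_inner {X : Type*} [TopologicalSpace X] {f : X → H}
    (hf : Continuous fun p : X × X => inner ℂ (f p.1) (f p.2)) : Continuous f := by
  refine continuous_iff_continuousAt.2 fun x => tendsto_iff_norm_sub_tendsto_zero.2 ?_
  have hdiag : Continuous fun y => inner ℂ (f y) (f y) :=
    hf.comp (continuous_id.prodMk continuous_id)
  have hcross : Continuous fun y => inner ℂ (f y) (f x) :=
    hf.comp (continuous_id.prodMk continuous_const)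
  have hsq (y : X) : ‖f y - f x‖ ^ 2 =
      (inner ℂ (f y) (f y)).re - 2 * (inner ℂ (f y) (f x)).re + (inner ℂ (f x) (f x)).re := by
    rw [norm_sub_sq (𝕜 := ℂ), ← inner_self_eq_norm_sq (𝕜 := ℂ), ← inner_self_eq_norm_sq (𝕜 := ℂ)]
    rfl
  have hlim : Tendsto (fun y => √(‖f y - f x‖ ^ 2)) (𝓝 x) (𝓝 0) := by
    simp only [hsq]
    have hcont : Continuous fun y =>
        √((inner ℂ (f y) (f y)).re - 2 * (inner ℂ (f y) (f x)).re + (inner ℂ (f x) (f x)).re) := by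
      fun_prop
    refine (hcont.tendsto x).trans_eq ?_
    congr 1
    rw [← hsq, sub_self, norm_zero, zero_pow two_ne_zero, Real.sqrt_zero]
  simpa only [Real.sqrt_sq (norm_nonneg _)] using hlim

theorem hasDerivAt_of_dense_inner [CompleteSpace H] {s : Set H} (hs : Dense s) {f f' : ℝ → H}
    (hf' : Continuous f')
    (h : ∀ χ ∈ s, ∀ t, HasDerivAt (fun t => inner ℂ χ (f t)) (inner ℂ χ (f' t)) t) (t : ℝ) :
    HasDerivAt f (f' t) t := by
  let F : ℝ → H := fun t => ∫ r in (0 : ℝ)..t, f' r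
  have hF (t : ℝ) : HasDerivAt F (f' t) t := (hf'.integral_hasStrictDerivAt 0 t).hasDerivAt
  have hconst (t : ℝ) : f t - F t = f 0 - F 0 := by
    refine hs.eq_of_inner_right (𝕜 := ℂ) fun χ hχ => ?_
    have hderiv (r : ℝ) : HasDerivAt (fun r => inner ℂ χ (f r - F r)) 0 r := by
      simpa [inner_sub_right] using
        (h χ hχ r).fun_sub ((hasDerivAt_const r χ).inner ℂ (hF r))
    exact is_const_of_deriv_eq_zero (fun r => (hderiv r).differentiableAt)
      (fun r => (hderiv r).deriv) t 0
  refine ((hF t).add_const (f 0 - F 0)).congr_of_eventuallyEq (.of_forall fun r => ?_)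
  simp [← hconst r]

end WeakToStrong

section FamiliesInH

variable {n : ℕ} {V V₁ V₂ : Type*} [NormedAddCommGroup V] [NormedSpace ℝ V]
  [FiniteDimensional ℝ V] [NormedAddCommGroup V₁] [NormedSpace ℝ V₁] [FiniteDimensional ℝ V₁]
  [NormedAddCommGroup V₂] [NormedSpace ℝ V₂] [FiniteDimensional ℝ V₂]
  {L : Submodule ℝ (Phase n)} (hL : L ≤ sympOrth L) (μ : Measure L) [μ.IsAddHaarMeasure]

namespace IsSchwartzFamily

theorem isSchwartz_algInner {K₁ : V₁ → 𝓢(Conf n, ℂ)} {K₂ : V₂ → 𝓢(Conf n, ℂ)}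
    (h₁ : IsSchwartzFamily K₁) (h₂ : IsSchwartzFamily K₂) :
    IsSchwartz fun v : V₁ × V₂ => algInner μ (K₁ v.1) (K₂ v.2) :=
  (h₁.isSchwartz_innerS_weyl_subtype L h₂).integral μ

variable {K K' : V → 𝓢(Conf n, ℂ)} {w : V}

theorem hasLineDerivAt_innerS (hK : IsSchwartzFamily K)
    (hK' : ∀ v η, HasLineDerivAt ℝ (fun v => K v η) (K' v η) v w) (φ : 𝓢(Conf n, ℂ)) (v : V) :
    HasLineDerivAt ℝ (fun v => innerS φ (K v)) (innerS φ (K' v)) v w := by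
  have hφ : (fun z : V × Conf n => conjS φ z.2).HasTemperateGrowth :=
    (conjS φ).hasTemperateGrowth.comp (ContinuousLinearMap.snd ℝ V (Conf n)).hasTemperateGrowth
  have hint := (hK.temperate_mul hφ).comp_injective
    (A := (LinearEquiv.prodComm ℝ (Conf n) V).toLinearMap)
    (LinearEquiv.prodComm ℝ (Conf n) V).injective
  exact hint.hasLineDerivAt_integral volume
    (f' := fun η v => (starRingEnd ℂ) (φ η) * K' v η)
    (fun η v => HasDerivAt.const_mul ((starRingEnd ℂ) (φ η)) (hK' v η)) v

theorem hasLineDerivAt_algInner (hK : IsSchwartzFamily K)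
    (hK' : ∀ v η, HasLineDerivAt ℝ (fun v => K v η) (K' v η) v w) (φ : 𝓢(Conf n, ℂ)) (v : V) :
    HasLineDerivAt ℝ (fun v => algInner μ φ (K v)) (algInner μ φ (K' v)) v w := by
  refine (hK.isSchwartz_innerS_weyl_right L φ).hasLineDerivAt_integral μ
    (f' := fun X v => innerS φ (weyl (X : Phase n) (K' v))) (fun X v => ?_) v
  simp only [innerS_weyl_right]
  exact hK.hasLineDerivAt_innerS hK' _ v

theorem continuous_toH (hK : IsSchwartzFamily K) : Continuous fun v => toH hL μ (K v) := by
  obtain ⟨a, ha⟩ := hK.isSchwartz_algInner μ hK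
  refine continuous_of_continuous_inner ?_
  simp only [inner_toH]
  exact ha ▸ a.continuous

theorem exists_norm_toH_le (hK : IsSchwartzFamily K) : ∃ C, ∀ v, ‖toH hL μ (K v)‖ ≤ C := by
  obtain ⟨a, ha⟩ := hK.isSchwartz_algInner μ hK
  refine ⟨√(SchwartzMap.seminorm ℝ 0 0 a), fun v => Real.le_sqrt_of_sq_le ?_⟩
  rw [norm_toH_sq]
  exact congrFun ha (v, v) ▸ SchwartzMap.norm_le_seminorm ℝ a (v, v)

theorem hasLineDerivAt_toH (hK : IsSchwartzFamily K) (hK'_fam : IsSchwartzFamily K')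
    (hK' : ∀ v η, HasLineDerivAt ℝ (fun v => K v η) (K' v η) v w) (v : V) :
    HasLineDerivAt ℝ (fun v => toH hL μ (K v)) (toH hL μ (K' v)) v w := by
  have hcont : Continuous fun t : ℝ => toH hL μ (K' (v + t • w)) :=
    (hK'_fam.continuous_toH hL μ).comp (by fun_prop)
  have h := hasDerivAt_of_dense_inner (f := fun t : ℝ => toH hL μ (K (v + t • w)))
    (denseRange_toH hL μ) hcont ?_ 0
  · simpa [HasLineDerivAt] using h
  rintro _ ⟨χ, rfl⟩ t
  simp only [inner_toH]
  exact hasDerivAt_comp_line (hK.hasLineDerivAt_algInner μ hK' χ (v + t • w))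

theorem isSchwartz_toH (hK : IsSchwartzFamily K) : IsSchwartz fun v => toH hL μ (K v) := by
  refine isSchwartz_of_mem_class
    (𝒞 := {g | ∃ K : V → 𝓢(Conf n, ℂ), IsSchwartzFamily K ∧ g = fun v => toH hL μ (K v)})
    ?_ ?_ ?_ ?_ ⟨K, hK, rfl⟩
  · rintro _ ⟨K, hK, rfl⟩
    exact hK.continuous_toH hL μ
  · rintro _ ⟨K, hK, rfl⟩
    exact hK.exists_norm_toH_le hL μ
  · rintro _ ⟨K, hK, rfl⟩ ℓ
    exact ⟨_, hK.linear_smul ℓ, funext fun v => ((toH hL μ).map_smul_of_tower (ℓ v) (K v)).symm⟩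
  · rintro _ ⟨K, hK, rfl⟩ w
    obtain ⟨K', hK'_fam, hK'⟩ := hK.exists_hasLineDerivAt w
    exact ⟨_, ⟨K', hK'_fam, rfl⟩, hK.hasLineDerivAt_toH hL μ hK'_fam hK'⟩

theorem isSchwartz_inner_toH (hK : IsSchwartzFamily K) (Ψ : DiracHilbert hL μ) :
    IsSchwartz fun v => inner ℂ Ψ (toH hL μ (K v)) := by
  obtain ⟨f, hf⟩ := hK.isSchwartz_toH hL μ
  exact ⟨SchwartzMap.postcompCLM ((innerSL ℂ Ψ).restrictScalars ℝ) f,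
    funext fun v => congrArg (inner ℂ Ψ) (congrFun hf v)⟩

theorem isSchwartz_diracPairing (hK : IsSchwartzFamily K) (Ψ : DiracHilbert hL μ) :
    IsSchwartz fun v => diracPairing hL μ Ψ (K v) := by
  simpa [diracPairing] using (hK.conj.isSchwartz_inner_toH hL μ Ψ).conj

variable [MeasurableSpace V] [BorelSpace V] (ν : Measure V) [ν.IsAddHaarMeasure]

theorem integrable_toH (hK : IsSchwartzFamily K) : Integrable (fun v => toH hL μ (K v)) ν := by
  have := FiniteDimensional.proper_real V
  obtain ⟨f, hf⟩ := hK.isSchwartz_toH hL μ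
  exact hf ▸ f.integrable

theorem integral_toH (hK : IsSchwartzFamily K) {J : 𝓢(Conf n, ℂ)}
    (hJ : ∀ η, J η = ∫ v, K v η ∂ν) : ∫ v, toH hL μ (K v) ∂ν = toH hL μ J := by
  refine eq_of_inner_toH hL μ fun χ => ?_
  rw [← integral_inner (hK.integrable_toH hL μ ν)]
  simp only [inner_toH, algInner]
  rw [← integral_integral_swap ((hK.isSchwartz_innerS_weyl_right L χ).integrable_prod μ ν)]
  simp only [innerS_weyl_right, hK.integral_innerS ν _ hJ]

theorem integral_diracPairing (hK : IsSchwartzFamily K) (Ψ : DiracHilbert hL μ)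
    {J : 𝓢(Conf n, ℂ)} (hJ : ∀ η, J η = ∫ v, K v η ∂ν) :
    ∫ v, diracPairing hL μ Ψ (K v) ∂ν = diracPairing hL μ Ψ J := by
  have hJ' (η : Conf n) : conjS J η = ∫ v, conjS (K v) η ∂ν := by
    simp only [conjS_apply, hJ, integral_conj]
  simp only [diracPairing]
  rw [← hK.conj.integral_toH hL μ ν hJ', ← inner_conj_symm,
    ← integral_inner (hK.conj.integrable_toH hL μ ν), ← integral_conj]
  simp only [inner_conj_symm]

end IsSchwartzFamily

end FamiliesInH

/-! ### Smeared states -/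

section Smearing

variable {n : ℕ}

instance isAddHaarMeasure_volume_phase : (volume : Measure (Phase n)).IsAddHaarMeasure := by
  rw [Measure.volume_eq_prod]
  infer_instance

/-- The reflection `(P, Q) ↦ (P, -Q)` of the phase space, which turns a Weyl operator into its
transpose. -/
def phaseReflection (n : ℕ) : Phase n →L[ℝ] Phase n :=
  (ContinuousLinearMap.id ℝ (Conf n)).prodMap (-ContinuousLinearMap.id ℝ (Conf n))

theorem phaseReflection_apply (Y : Phase n) : phaseReflection n Y = (Y.1, -Y.2) := rfl

/-- The value at `(ξ, η)` of the integral kernel of `∫ F(Y) exp (i Ω(Y)) dY`. -/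
def weylKernel (F : 𝓢(Phase n, ℂ)) (z : Conf n × Conf n) : ℂ :=
  ∫ P, Complex.exp (Complex.I * (dotp P ((2 : ℝ)⁻¹ • (z.1 + z.2)) : ℂ)) * F (P, z.1 - z.2)

theorem isSchwartz_weylKernel (F : 𝓢(Phase n, ℂ)) : IsSchwartz (weylKernel F) := by
  let T : Conf n × Conf n →ₗ[ℝ] Conf n × Conf n :=
    ((2 : ℝ)⁻¹ • (LinearMap.fst ℝ (Conf n) (Conf n) + LinearMap.snd ℝ (Conf n) (Conf n))).prod
      (LinearMap.fst ℝ (Conf n) (Conf n) - LinearMap.snd ℝ (Conf n) (Conf n))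
  have hT : Function.Injective T := by
    refine (injective_iff_map_eq_zero T).2 fun z hz => ?_
    obtain ⟨hadd, hsub⟩ : z.1 + z.2 = 0 ∧ z.1 - z.2 = 0 := by
      simpa [T, ← smul_add] using hz
    obtain h : z.1 = z.2 := sub_eq_zero.1 hsub
    have h₂ : z.2 = 0 := by simpa [h, ← two_smul ℝ] using hadd
    exact Prod.ext (h.trans h₂) h₂
  have hB : Function.Surjective (innerSL ℝ : Conf n →L[ℝ] Conf n →L[ℝ] ℝ) :=
    (InnerProductSpace.toDual ℝ (Conf n)).surjective
  convert (isSchwartz_partialFourier volume F hB).comp_injective hT using 2 with z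
  simp only [weylKernel, partialFourier, dotp_eq_inner, T]
  rfl

theorem integral_smul_weyl_phaseReflection (F : 𝓢(Phase n, ℂ)) (χ : 𝓢(Conf n, ℂ)) (η : Conf n) :
    ∫ Y, (F Y • weyl (phaseReflection n Y) χ) η = ∫ ξ, χ ξ * weylKernel F (ξ, η) := by
  have hint : Integrable (fun Y => (F Y • weyl (phaseReflection n Y) χ) η)
      ((volume : Measure (Conf n)).prod volume) :=
    (IsSchwartzFamily.smul_weyl F (phaseReflection n) χ).integrable_apply volume η
  rw [Measure.volume_eq_prod, integral_prod_symm _ hint,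
    ← integral_add_left_eq_self (fun ξ => χ ξ * weylKernel F (ξ, η)) η]
  congr 1 with Q
  rw [weylKernel, ← integral_const_mul]
  congr 1 with P
  have hphase : dotp P η - dotp P (-Q) / 2 = dotp P ((2 : ℝ)⁻¹ • (η + Q + η)) := by
    simp only [dotp_eq_inner, inner_neg_right, real_inner_smul_right, inner_add_right]
    ring
  rw [smul_apply, weyl_apply, phaseReflection_apply, smul_eq_mul, weylPhase,
    sub_neg_eq_add, add_sub_cancel_left, hphase]
  ring

variable {L : Submodule ℝ (Phase n)} (hL : L ≤ sympOrth L) (μ : Measure L) [μ.IsAddHaarMeasure]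

theorem diracPairing_smul (Ψ : DiracHilbert hL μ) (c : ℂ) (χ : 𝓢(Conf n, ℂ)) :
    diracPairing hL μ Ψ (c • χ) = c * diracPairing hL μ Ψ χ := by
  have h : conjS (c • χ) = (starRingEnd ℂ) c • conjS χ := by
    ext η
    simp [conjS_apply]
  simp only [diracPairing, h, map_smul, inner_smul_left, Complex.conj_conj]

theorem exists_isSmeared {Ψ : DiracHilbert hL μ} {ψD : 𝓢'(Conf n, ℂ)}
    (hΨ : ∀ χ, ψD χ = diracPairing hL μ Ψ χ) (F : 𝓢(Phase n, ℂ)) :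
    ∃ g : 𝓢(Conf n, ℂ), IsSmeared ψD F g := by
  obtain ⟨K, hK, hK_apply⟩ := exists_isSchwartzFamily (isSchwartz_weylKernel F)
  obtain ⟨g, hg⟩ := hK.isSchwartz_diracPairing hL μ Ψ
  refine ⟨g, fun χ => ?_⟩
  have hW := IsSchwartzFamily.smul_weyl F (phaseReflection n) χ
  have hF (Y : Phase n) : F Y * weylDistr Y ψD χ =
      diracPairing hL μ Ψ (F Y • weyl (phaseReflection n Y) χ) := by
    rw [diracPairing_smul, weylDistr, hΨ, phaseReflection_apply]
  simp only [hF]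
  obtain ⟨Γ, hΓ⟩ := hW.isSchwartz_diracPairing hL μ Ψ
  refine ⟨hΓ ▸ Γ.integrable, ?_⟩
  obtain ⟨J, hJ⟩ := hW.exists_integral_eq volume
  have hχ : (fun z : Conf n × Conf n => χ z.1).HasTemperateGrowth :=
    χ.hasTemperateGrowth.comp (ContinuousLinearMap.fst ℝ (Conf n) (Conf n)).hasTemperateGrowth
  have hχK : IsSchwartzFamily fun ξ => χ ξ • K ξ := hK.temperate_mul hχ
  have hJ' (η : Conf n) : J η = ∫ ξ, (χ ξ • K ξ) η := by
    rw [hJ, integral_smul_weyl_phaseReflection]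
    simp only [smul_apply, smul_eq_mul, hK_apply]
  rw [hW.integral_diracPairing hL μ volume Ψ hJ, ← hχK.integral_diracPairing hL μ volume Ψ hJ']
  simp only [diracPairing_smul, hg, mul_comm]

end Smearing

section Splitting

theorem integral_eq_integral_integral_add {E : Type*} [NormedAddCommGroup E] [NormedSpace ℝ E]
    [FiniteDimensional ℝ E] [MeasurableSpace E] [BorelSpace E] {G M : Submodule ℝ E}
    (h : IsCompl G M) {σ : Measure G} [σ.IsAddHaarMeasure] {ν : Measure M} [ν.IsAddHaarMeasure]
    {μ : Measure E}
    (hν : Measure.map (fun p : G × M => (p.1 : E) + (p.2 : E)) (σ.prod ν) = μ)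
    {f : E → ℂ} (hf : Integrable f μ) :
    ∫ Y, f Y ∂μ = ∫ x : G, ∫ z : M, f ((x : E) + (z : E)) ∂ν ∂σ := by
  have hemb : MeasurableEmbedding fun p : G × M => (p.1 : E) + (p.2 : E) :=
    (G.prodEquivOfIsCompl M h).toContinuousLinearEquiv.toHomeomorph.measurableEmbedding
  subst hν
  rw [hemb.integral_map]
  exact integral_prod _ (hemb.integrable_map_iff.1 hf)

variable {n : ℕ} {L G : Submodule ℝ (Phase n)}

/-- Fourier inversion at the origin for the pairing of `L` with `G` by the symplectic form, with
constant `Δ`. -/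
def IsInversionConstant (μ : Measure L) (σ : Measure G) (Δ : ℝ) : Prop :=
  ∀ ρ : 𝓢(G, ℂ), ∫ X : L, (∫ Y : G,
    ρ Y * Complex.exp (Complex.I * (symp (X : Phase n) (Y : Phase n) : ℂ)) ∂σ) ∂μ = ρ 0 * (Δ : ℂ)

theorem integrable_phase_mul_schwartz (X : Phase n) (Θ : 𝓢(Phase n, ℂ)) :
    Integrable fun Y => Complex.exp (Complex.I * (symp X Y : ℂ)) * Θ Y := by
  have hphase : Continuous fun Y => Complex.exp (Complex.I * (symp X Y : ℂ)) := by
    have : Continuous fun Y => symp X Y :=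
      (sympForm n X).continuous_of_finiteDimensional
    fun_prop
  refine (Θ.integrable (μ := volume)).bdd_mul (c := 1) hphase.aestronglyMeasurable
    (.of_forall fun Y => ?_)
  rw [norm_cexp_I_mul_ofReal]

theorem IsInversionConstant.integral_integral_phase {μ : Measure L} {σ : Measure G}
    [σ.IsAddHaarMeasure] {Δ : ℝ} (hΔ : IsInversionConstant μ σ Δ) (hG : IsCompl G (sympOrth L))
    {ν : Measure (sympOrth L)} [ν.IsAddHaarMeasure]
    (hν : Measure.map (fun p : G × sympOrth L => (p.1 : Phase n) + (p.2 : Phase n))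
      (σ.prod ν) = volume) (Θ : 𝓢(Phase n, ℂ)) :
    ∫ X : L, (∫ Y, Complex.exp (Complex.I * (symp (X : Phase n) Y : ℂ)) * Θ Y) ∂μ =
      Δ * ∫ z : sympOrth L, Θ z ∂ν := by
  let e := (sympOrth L).prodEquivOfIsCompl G hG.symm
  obtain ⟨ρ, hρ⟩ := (IsSchwartz.comp_injective ⟨Θ, rfl⟩ (A := e.toLinearMap) e.injective).integral ν
  have hρ_apply (x : G) : ρ x = ∫ z : sympOrth L, Θ ((x : Phase n) + (z : Phase n)) ∂ν := by
    simp [hρ, e, add_comm]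
  have hfiber (X : L) : ∫ Y, Complex.exp (Complex.I * (symp (X : Phase n) Y : ℂ)) * Θ Y =
      ∫ Y : G, ρ Y * Complex.exp (Complex.I * (symp (X : Phase n) (Y : Phase n) : ℂ)) ∂σ := by
    rw [integral_eq_integral_integral_add hG hν (integrable_phase_mul_schwartz _ Θ)]
    congr 1 with x
    have hX (z : sympOrth L) : symp (X : Phase n) ((x : Phase n) + (z : Phase n)) =
        symp (X : Phase n) (x : Phase n) := by
      rw [← sympForm_apply, map_add, sympForm_apply, sympForm_apply,
        mem_sympOrth.1 z.2 X X.2, add_zero]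
    simp only [hX, integral_const_mul, hρ_apply, mul_comm]
  simp only [hfiber]
  rw [hΔ, hρ_apply, mul_comm]
  simp only [Submodule.coe_zero, zero_add]

end Splitting

section SmearedState

variable {n : ℕ} {L : Submodule ℝ (Phase n)} (hL : L ≤ sympOrth L) (μ : Measure L)
  [μ.IsAddHaarMeasure] (φ : 𝓢(Conf n, ℂ)) (Ψ : DiracHilbert hL μ)

theorem diracPairing_weyl_reflection (χ : 𝓢(Conf n, ℂ)) (Y : Phase n) :
    diracPairing hL μ Ψ (weyl (Y.1, -Y.2) χ) =
      inner ℂ (toH hL μ (weyl (-Y) (conjS χ))) Ψ := by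
  rw [diracPairing, conjS_weyl]

theorem isSchwartz_mul_inner_toH_weyl_neg (F : 𝓢(Phase n, ℂ)) :
    IsSchwartz fun Y => F Y * inner ℂ (toH hL μ (weyl (-Y) φ)) Ψ := by
  simpa only [diracPairing_smul, phaseReflection_apply, diracPairing_weyl_reflection,
    conjS_conjS] using (IsSchwartzFamily.smul_weyl F (phaseReflection n)
      (conjS φ)).isSchwartz_diracPairing hL μ Ψ

theorem inner_toH_weyl_neg_weyl_neg (X : L) (Y : Phase n) :
    inner ℂ (toH hL μ (weyl (-Y) (weyl (-(X : Phase n)) φ))) Ψ =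
      Complex.exp (Complex.I * (symp (X : Phase n) Y : ℂ)) *
        inner ℂ (toH hL μ (weyl (-Y) φ)) Ψ := by
  have htrivial : toH hL μ (weyl (-(X : Phase n)) (weyl (-Y) φ)) = toH hL μ (weyl (-Y) φ) :=
    toH_weyl hL μ (-X) (weyl (-Y) φ)
  have hsymp : symp (-Y) (-(X : Phase n)) = -symp (X : Phase n) Y := by
    rw [symp_swap (X : Phase n) Y, neg_neg]
    simp only [← sympForm_apply, map_neg, LinearMap.neg_apply, neg_neg]
  rw [weyl_swap, map_smul, inner_smul_left, htrivial, ← Complex.exp_conj, map_mul, Complex.conj_I,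
    Complex.conj_ofReal, hsymp, Complex.ofReal_neg, neg_mul_neg]

variable {G : Submodule ℝ (Phase n)} {σ : Measure G} [σ.IsAddHaarMeasure] {Δ : ℝ}
  (hΔ : IsInversionConstant μ σ Δ) (hG : IsCompl G (sympOrth L))
  {ν : Measure (sympOrth L)} [ν.IsAddHaarMeasure]
  (hν : Measure.map (fun p : G × sympOrth L => (p.1 : Phase n) + (p.2 : Phase n))
    (σ.prod ν) = volume)
  {ψD : 𝓢'(Conf n, ℂ)} {Ψ}

include hΔ hG hν

theorem algInner_of_isSmeared (hΨ : ∀ χ, ψD χ = diracPairing hL μ Ψ χ) {F : 𝓢(Phase n, ℂ)}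
    {g : 𝓢(Conf n, ℂ)} (hg : IsSmeared ψD F g) :
    algInner μ φ g =
      Δ * ∫ z : sympOrth L, F z * inner ℂ (toH hL μ φ) (weylH hL μ z Ψ) ∂ν := by
  obtain ⟨Θ, hΘ⟩ := isSchwartz_mul_inner_toH_weyl_neg hL μ φ Ψ F
  have hX (X : L) : innerS φ (weyl (X : Phase n) g) =
      ∫ Y, Complex.exp (Complex.I * (symp (X : Phase n) Y : ℂ)) * Θ Y := by
    have h := (hg (conjS (weyl (-(X : Phase n)) φ))).2
    rw [integral_mul_eq_innerS, conjS_conjS] at h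
    rw [innerS_weyl_right, h]
    congr 1 with Y
    rw [weylDistr, hΨ, diracPairing_weyl_reflection, conjS_conjS, inner_toH_weyl_neg_weyl_neg,
      mul_left_comm, ← congrFun hΘ Y]
  simp only [algInner, hX]
  rw [hΔ.integral_integral_phase hG hν]
  simp only [hΘ, inner_toH_weyl_neg]

end SmearedState

section StrongContinuity

variable {n : ℕ} {L : Submodule ℝ (Phase n)} (hL : L ≤ sympOrth L) (μ : Measure L)
  [μ.IsAddHaarMeasure]

theorem continuous_toH_weyl (M : Submodule ℝ (Phase n)) (φ : 𝓢(Conf n, ℂ)) :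
    Continuous fun z : M => toH hL μ (weyl (z : Phase n) φ) := by
  refine continuous_iff_continuousAt.2 fun z₀ => ?_
  obtain ⟨f, hf⟩ := exists_schwartz_eventuallyEq_one z₀
  refine ((IsSchwartzFamily.smul_weyl f M.subtypeL φ).continuous_toH hL μ).continuousAt.congr
    (hf.mono fun z hz => ?_)
  simp [hz]

theorem continuous_weylH_apply (Ψ : DiracHilbert hL μ) : Continuous fun z => weylH hL μ z Ψ := by
  refine continuous_of_uniform_approx_of_continuous fun u hu => ?_
  obtain ⟨ε, hε, hεu⟩ := Metric.mem_uniformity_dist.1 hu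
  obtain ⟨φ, hφ⟩ := (denseRange_toH hL μ).exists_dist_lt Ψ hε
  refine ⟨fun z => weylH hL μ z (toH hL μ φ), ?_, fun z => hεu ?_⟩
  · simpa only [weylH_toH] using continuous_toH_weyl hL μ (sympOrth L) φ
  · rwa [LinearIsometryEquiv.dist_map]

end StrongContinuity

section MatrixElement

variable {n : ℕ} {L : Submodule ℝ (Phase n)} (hL : L ≤ sympOrth L) (μ : Measure L)
  [μ.IsAddHaarMeasure]

theorem integrable_smul_weylH (ν : Measure (sympOrth L)) [ν.IsAddHaarMeasure]
    (F : 𝓢(Phase n, ℂ)) (Ψ : DiracHilbert hL μ) :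
    Integrable (fun z : sympOrth L => F z • weylH hL μ z Ψ) ν := by
  have := FiniteDimensional.proper_real (sympOrth L)
  obtain ⟨f, hf⟩ := IsSchwartz.comp_injective ⟨F, rfl⟩ (sympOrth L).subtype_injective
  have hfF : Integrable (fun z : sympOrth L => F z) ν := hf ▸ f.integrable
  refine (hfF.norm.mul_const ‖Ψ‖).mono'
    (hfF.aestronglyMeasurable.smul (continuous_weylH_apply hL μ Ψ).aestronglyMeasurable)
    (.of_forall fun z => ?_)
  rw [norm_smul, LinearIsometryEquiv.norm_map]

variable {G : Submodule ℝ (Phase n)} {σ : Measure G} [σ.IsAddHaarMeasure] {Δ : ℝ}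
  (hΔ : IsInversionConstant μ σ Δ) (hG : IsCompl G (sympOrth L))
  {ν : Measure (sympOrth L)} [ν.IsAddHaarMeasure]
  (hν : Measure.map (fun p : G × sympOrth L => (p.1 : Phase n) + (p.2 : Phase n))
    (σ.prod ν) = volume)
  {ψD : 𝓢'(Conf n, ℂ)} {Ψ : DiracHilbert hL μ} (hΨ : ∀ χ, ψD χ = diracPairing hL μ Ψ χ)

include hΔ hG hν hΨ

theorem toH_of_isSmeared {F : 𝓢(Phase n, ℂ)} {g : 𝓢(Conf n, ℂ)} (hg : IsSmeared ψD F g) :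
    toH hL μ g = (Δ : ℂ) • ∫ z : sympOrth L, F z • weylH hL μ z Ψ ∂ν := by
  refine eq_of_inner_toH hL μ fun φ => ?_
  rw [inner_toH, algInner_of_isSmeared hL μ φ hΔ hG hν hΨ hg, inner_smul_right,
    ← integral_inner (integrable_smul_weylH hL μ ν F Ψ)]
  simp only [inner_smul_right]

theorem isMatrixElement_of_forall_eq_integral {R : 𝓢'(Phase n, ℂ)}
    (hR : ∀ F : 𝓢(Phase n, ℂ),
      R F = ∫ z : sympOrth L, F z * (Δ * inner ℂ Ψ (weylH hL μ z Ψ)) ∂ν) :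
    IsMatrixElement ψD ψD R := fun F => by
  obtain ⟨g, hg⟩ := exists_isSmeared hL μ hΨ F
  refine ⟨g, hg, ?_⟩
  rw [hΨ, diracPairing, conjS_conjS, inner_conj_symm, toH_of_isSmeared hL μ hΔ hG hν hΨ hg,
    inner_smul_right, ← integral_inner (integrable_smul_weylH hL μ ν F Ψ), hR,
    ← integral_const_mul]
  simp only [inner_smul_right, mul_left_comm]

end MatrixElement

section Restriction

variable {n : ℕ} {G M : Submodule ℝ (Phase n)}

theorem exists_temperedDistribution_eq_integral (ν : Measure M) [ν.IsAddHaarMeasure] {B : M → ℂ}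
    (hB : Continuous B) {C : ℝ} (hC : ∀ z, ‖B z‖ ≤ C) :
    ∃ R : 𝓢'(Phase n, ℂ), ∀ F : 𝓢(Phase n, ℂ), R F = ∫ z : M, F z * B z ∂ν := by
  have hLp : MemLp B ⊤ ν := memLp_top_of_bound hB.aestronglyMeasurable C (.of_forall hC)
  have hanti : AntilipschitzWith 1 M.subtypeₗᵢ := M.subtypeₗᵢ.antilipschitz
  let restrict : 𝓢(Phase n, ℂ) →L[ℂ] 𝓢(M, ℂ) :=
    SchwartzMap.compCLMOfAntilipschitz ℂ M.subtypeL.hasTemperateGrowth hanti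
  refine ⟨PointwiseConvergenceCLM.precomp _ restrict (Lp.toTemperedDistribution hLp.toLp),
    fun F => ?_⟩
  have h := Lp.toTemperedDistribution_apply hLp.toLp (restrict F)
  refine h.trans (integral_congr_ae ?_)
  filter_upwards [hLp.coeFn_toLp] with z hz
  rw [hz]
  rfl

theorem isRestriction_smul_delta (hM : IsCompl G M) (σ : Measure G) [σ.IsAddHaarMeasure]
    (ν : Measure M) [ν.IsAddHaarMeasure]
    (hν : Measure.map (fun p : G × M => (p.1 : Phase n) + (p.2 : Phase n)) (σ.prod ν) = volume)
    {B : M → ℂ} (hB : Continuous B) {R : 𝓢'(Phase n, ℂ)}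
    (hR : ∀ F : 𝓢(Phase n, ℂ), R F = ∫ z : M, F z * B z ∂ν) :
    IsRestriction R G σ (B 0 • TemperedDistribution.delta 0) := by
  intro N ν' hN _ hν' f
  let τ := complementEquiv hN hM
  let π : N →ₗ[ℝ] G := G.projectionOnto M hM ∘ₗ N.subtype
  have hτ : ν'.map τ = ν := map_complementEquiv hN hM σ volume ν' ν hν' hν
  have hπτ (y : N) : (τ y : Phase n) = ((-π y : G) : Phase n) + (y : Phase n) := by
    rw [← projectionOnto_add_complementEquiv hN hM y, Submodule.coe_neg]
    exact (neg_add_cancel_left _ _).symm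
  refine ⟨Set.univ, univ_mem, fun y => f (-π y) * B (τ y), ?_, ?_, fun χ _ _ F hF => ?_⟩
  · have hπ : Continuous π := π.continuous_of_finiteDimensional
    exact ((f.continuous.comp hπ.neg).mul (hB.comp τ.continuous)).continuousOn
  · simp only [map_zero, neg_zero]
    exact mul_comm _ _
  · have hemb : MeasurableEmbedding τ := τ.toHomeomorph.measurableEmbedding
    rw [hR, ← hτ, hemb.integral_map]
    congr 1 with y
    change F (τ y) * B (τ y) = χ y * (f (-π y) * B (τ y))
    rw [hπτ, hF]
    ring

end Restriction

theorem exists_isMatrixElement_isRestriction_smul_delta {n : ℕ} {L G : Submodule ℝ (Phase n)}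
    (hL : L ≤ sympOrth L) (hG : IsCompl G (sympOrth L)) (μ : Measure L) [μ.IsAddHaarMeasure]
    (σ : Measure G) [σ.IsAddHaarMeasure] {Δ : ℝ} (hΔ : IsInversionConstant μ σ Δ)
    {ψD : 𝓢'(Conf n, ℂ)} {Ψ : DiracHilbert hL μ}
    (hΨ : ∀ χ, ψD χ = diracPairing hL μ Ψ χ) :
    ∃ R : 𝓢'(Phase n, ℂ), IsMatrixElement ψD ψD R ∧
      IsRestriction R G σ ((Δ * inner ℂ Ψ Ψ) • TemperedDistribution.delta 0) := by
  obtain ⟨ν, _, hν⟩ := exists_isAddHaarMeasure_map_add_eq hG σ (volume : Measure (Phase n))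
  let B (z : sympOrth L) : ℂ := Δ * inner ℂ Ψ (weylH hL μ z Ψ)
  have hB : Continuous B :=
    continuous_const.mul (continuous_const.inner (continuous_weylH_apply hL μ Ψ))
  have hbound (z : sympOrth L) : ‖B z‖ ≤ ‖(Δ : ℂ)‖ * (‖Ψ‖ * ‖Ψ‖) := by
    rw [norm_mul]
    gcongr
    exact (norm_inner_le_norm _ _).trans_eq (by rw [LinearIsometryEquiv.norm_map])
  obtain ⟨R, hR⟩ := exists_temperedDistribution_eq_integral ν hB hbound
  have hB0 : B 0 = Δ * inner ℂ Ψ Ψ := by simp only [B, weylH_zero]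
  exact ⟨R, isMatrixElement_of_forall_eq_integral hL μ hΔ hG hν hΨ hR,
    hB0 ▸ isRestriction_smul_delta hG σ ν hν hB hR⟩

theorem lemma8_general {n : ℕ} {L G : Submodule ℝ (Phase n)} (hL : L ≤ sympOrth L)
    (hG : IsCompl G (sympOrth L)) (μ : Measure L) [μ.IsAddHaarMeasure] (σ : Measure G)
    [σ.IsAddHaarMeasure] :
    ∃ Δ : ℝ, 0 < Δ ∧
      (∀ ρ : 𝓢(G, ℂ),
        (∀ X : L, Integrable (fun Y : G =>
          ρ Y * Complex.exp (Complex.I * (symp (X : Phase n) (Y : Phase n) : ℂ))) σ) ∧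
        Integrable (fun X : L => ∫ Y : G,
          ρ Y * Complex.exp (Complex.I * (symp (X : Phase n) (Y : Phase n) : ℂ)) ∂σ) μ ∧
        ∫ X : L, (∫ Y : G,
          ρ Y * Complex.exp (Complex.I * (symp (X : Phase n) (Y : Phase n) : ℂ)) ∂σ) ∂μ
          = ρ 0 * (Δ : ℂ)) ∧
      (∀ ψD ∈ diracSpace μ,
        ∃ R : 𝓢'(Phase n, ℂ), IsMatrixElement ψD ψD R ∧
          ∃ S : 𝓢'(G, ℂ), IsRestriction R G σ S ∧
            ∀ ρ : 𝓢(G, ℂ), ρ 0 = 1 / (Δ : ℂ) → IsDiracInnerSelf μ ψD (S ρ)) := by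
  obtain ⟨Δ, hpos, hΔ⟩ := exists_sympPairing_inversion hG μ σ
  refine ⟨Δ, hpos, hΔ, fun ψD hψD => ?_⟩
  obtain ⟨u, hu⟩ := id hψD
  obtain ⟨Ψ, -, hΨ⟩ := hu.exists_tendsto_toH hL μ
  obtain ⟨R, hR, hS⟩ := exists_isMatrixElement_isRestriction_smul_delta hL hG μ σ
    (fun ρ => (hΔ ρ).2.2) hΨ
  refine ⟨R, hR, _, hS, fun ρ hρ => ?_⟩
  have hΔ0 : (Δ : ℂ) ≠ 0 := Complex.ofReal_ne_zero.mpr hpos.ne'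
  have hSρ : ((Δ * inner ℂ Ψ Ψ) • TemperedDistribution.delta (0 : G)) ρ = inner ℂ Ψ Ψ := by
    change Δ * inner ℂ Ψ Ψ * ρ 0 = _
    rw [hρ]
    field_simp
  rw [hSρ]
  exact isDiracInnerSelf_inner_self hL μ hψD hΨ

theorem lemma8 (n k : ℕ) (L G : Submodule ℝ (Phase n))
    (hL : IsIsotropicPlane k L) (hG : IsGaugeSurface k L G)
    (μ : Measure L) [μ.IsAddHaarMeasure] (σ : Measure G) [σ.IsAddHaarMeasure] :
    ∃ Δ : ℝ, 0 < Δ ∧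
      (∀ ρ : 𝓢(G, ℂ),
        (∀ X : L, Integrable (fun Y : G =>
          ρ Y * Complex.exp (Complex.I * (symp (X : Phase n) (Y : Phase n) : ℂ))) σ) ∧
        Integrable (fun X : L => ∫ Y : G,
          ρ Y * Complex.exp (Complex.I * (symp (X : Phase n) (Y : Phase n) : ℂ)) ∂σ) μ ∧
        ∫ X : L, (∫ Y : G,
          ρ Y * Complex.exp (Complex.I * (symp (X : Phase n) (Y : Phase n) : ℂ)) ∂σ) ∂μ
          = ρ 0 * (Δ : ℂ)) ∧
      (∀ ψD ∈ diracSpace μ,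
        ∃ R : 𝓢'(Phase n, ℂ), IsMatrixElement ψD ψD R ∧
          ∃ S : 𝓢'(G, ℂ), IsRestriction R G σ S ∧
            ∀ ρ : 𝓢(G, ℂ), ρ 0 = 1 / (Δ : ℂ) → IsDiracInnerSelf μ ψD (S ρ)) :=
  lemma8_general hL.le_sympOrth (hG.isCompl_sympOrth hL) μ σ

end
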